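/- **Theorem 3.17 (Duality for distributive inverse semigroups).** The category of distributive inverse semigroups and callitic morphisms is dually equivalent to the category of coherent étale groupoids and coherent continuous covering functors. Here the terms are as follows. *Distributive inverse semigroups.* In an inverse semigroup $S$, order is the natural partial order: $s\le t$ iff $s=te$ for some idempotent $e$. Elements $s,t$ are *compatible* if $s^{-1}t$ and $st^{-1}$ are idempotents. $S$ is *distributive* if every finite subset of pairwise compatible elements (including the empty set, so that $S$ has a zero $0$) has a join, and multiplication on either side distributes over these joins. A *filter* in a partially ordered set with least element $0$ is a non-empty, down-directed, upward closed subset not containing $0$; it is *prime* if $a\vee b\in F$ implies $a\in F$ or $b\in F$, and *completely prime* if $\bigvee_i a_i\in F$ implies $a_i\in F$ for some $i$ (whenever these joins exist). A *callitic morphism* $\theta\colon S\to T$ of distributive inverse semigroups is a semigroup homomorphism that preserves joins of finite compatible subsets (in particular $0$) and satisfies: - (DC1) if $t\le\theta(s_1)$ and $t\le\theta(s_2)$, then there is $s\le s_1,s_2$ with $t\le\theta(s)$; - (DC2) $\theta^{-1}(P)\neq\emptyset$ for every prime filter $P$ of $T$. *Coherent étale groupoids.* For an element $x$ of a groupoid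 $G$ let $\mathbf d(x)=x^{-1}x$, and let $G_o$ be the set of identities. An *étale groupoid* is a groupoid with a topology for which inversion and multiplication are continuous and $\mathbf d\colon G\to G_o$ is a local homeomorphism. A *bisection* is a subset $A\subseteq G$ with $A^{-1}A,\,AA^{-1}\subseteq G_o$. Let $\mathsf B(G)$ be the set of open bisections, ordered by inclusion. Compactness does not include the Hausdorff property. An étale groupoid $G$ is *coherent* if: - (C1) the compact-open bisections form a basis for the topology of $G$; - (C2) the product $AB=\{ab : a\in A,\ b\in B,\ ab \text{ defined}\}$ of any two compact-open bisections is a compact-open bisection; - (C3) $G$ is *sober*: the map $g\mapsto\{U\in\mathsf B(G) : g\in U\}$ is a homeomorphism from $G$ onto the set of completely prime filters of $\mathsf B(G)$, with the topology whose basic open sets are $X_U=\{F : U\in F\}$, $U\in\mathsf B(G)$. A functor $\alpha\colon G\to H$ of groupoids is *covering* if $\mathbf d(g)=\mathbf d(g')$ and $\alpha(g)=\alpha(g')$ imply $g=g'$, and if whenever $e$ is an identity of $G$ and $h\in H$ satisfies $\alpha(e)=\mathbf d(h)$, there is $g\in G$ with $\mathbf d(g)=e$ and $\alpha(g)=h$.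 A continuous map is *coherent* if the inverse image of every compact-open set is compact-open. -/

import Mathlib

open CategoryTheory

universe u v w

namespace NCStone

/-! ### Inverse semigroups and the natural partial order -/

/-- An inverse semigroup: every element `s` has a unique inverse `s⁻¹`, that is, a unique `t` with
`s * t * s = s` and `t * s * t = t`. -/
class InverseSemigroup (S : Type u) extends Semigroup S, Inv S where
  mul_inv_mul : ∀ s : S, s * s⁻¹ * s = s
  inv_mul_inv : ∀ s : S, s⁻¹ * s * s⁻¹ = s⁻¹
  inv_unique : ∀ s t : S, s * t * s = s → t * s * t = t → t = s⁻¹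

section InverseSemigroup

variable {S : Type u} [InverseSemigroup S]

theorem idem_eq_inv {x : S} (hx : x * x = x) : x = x⁻¹ :=
  InverseSemigroup.inv_unique x x (by rw [hx, hx]) (by rw [hx, hx])

theorem inv_inv_eq (x : S) : x = x⁻¹⁻¹ :=
  InverseSemigroup.inv_unique x⁻¹ x (InverseSemigroup.inv_mul_inv x)
    (InverseSemigroup.mul_inv_mul x)

theorem idem_mul_idem {e f : S} (he : e * e = e) (hf : f * f = f) :
    e * f * (e * f) = e * f := by
  have h1 := InverseSemigroup.mul_inv_mul (e * f)
  have h2 := InverseSemigroup.inv_mul_inv (e * f)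
  have h3 : f * (e * f)⁻¹ * e = (e * f)⁻¹ := by
    apply InverseSemigroup.inv_unique
    · calc e * f * (f * (e * f)⁻¹ * e) * (e * f)
          = e * (f * f) * (e * f)⁻¹ * ((e * e) * f) := by simp only [mul_assoc]
        _ = e * f := by rw [he, hf, h1]
    · calc f * (e * f)⁻¹ * e * (e * f) * (f * (e * f)⁻¹ * e)
          = f * ((e * f)⁻¹ * ((e * e) * (f * f)) * (e * f)⁻¹) * e := by simp only [mul_assoc]
        _ = f * (e * f)⁻¹ * e := by rw [he, hf, h2]
  have h4 : (e * f)⁻¹ * (e * f)⁻¹ = (e * f)⁻¹ := by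
    calc (e * f)⁻¹ * (e * f)⁻¹ = (f * (e * f)⁻¹ * e) * (f * (e * f)⁻¹ * e) := by rw [h3]
      _ = f * ((e * f)⁻¹ * (e * f) * (e * f)⁻¹) * e := by simp only [mul_assoc]
      _ = (e * f)⁻¹ := by rw [h2, h3]
  have h5 : e * f = (e * f)⁻¹ := (inv_inv_eq _).trans (idem_eq_inv h4).symm
  rw [h5, h4]

theorem idem_comm {e f : S} (he : e * e = e) (hf : f * f = f) : e * f = f * e := by
  have h1 := idem_mul_idem he hf
  have h2 := idem_mul_idem hf he
  have h3 : f * e = (e * f)⁻¹ := by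
    apply InverseSemigroup.inv_unique
    · calc e * f * (f * e) * (e * f) = e * (f * f) * ((e * e) * f) := by simp only [mul_assoc]
        _ = e * f := by rw [he, hf, h1]
    · calc f * e * (e * f) * (f * e) = f * (e * e) * ((f * f) * e) := by simp only [mul_assoc]
        _ = f * e := by rw [he, hf, h2]
  rw [h3]
  exact idem_eq_inv h1

/-- The natural partial order: `s ≤ t` if and only if `s = t * e` for some idempotent `e`. -/
instance naturalOrder : PartialOrder S where
  le s t := ∃ e : S, e * e = e ∧ s = t * e
  le_refl s := ⟨s⁻¹ * s, by rw [← mul_assoc, InverseSemigroup.inv_mul_inv],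
    by rw [← mul_assoc, InverseSemigroup.mul_inv_mul]⟩
  le_trans := by
    rintro s t r ⟨e, he, rfl⟩ ⟨f, hf, rfl⟩
    exact ⟨f * e, idem_mul_idem hf he, mul_assoc _ _ _⟩
  le_antisymm := by
    rintro s t ⟨e, he, hs⟩ ⟨f, hf, ht⟩
    have h1 : s * e = s := by rw [hs, mul_assoc, he]
    calc s = s * f * e := by rw [← ht, ← hs]
      _ = s * e * f := by rw [mul_assoc, mul_assoc, idem_comm hf he]
      _ = t := by rw [h1, ← ht]

/-- Two elements are compatible if `s⁻¹ * t` and `s * t⁻¹` are idempotents. -/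
def Compatible (s t : S) : Prop :=
  IsIdempotentElem (s⁻¹ * t) ∧ IsIdempotentElem (s * t⁻¹)

/-- A subset is compatible if its elements are pairwise compatible. -/
def CompatibleSet (A : Set S) : Prop :=
  ∀ s ∈ A, ∀ t ∈ A, Compatible s t

end InverseSemigroup

/-- A distributive inverse semigroup: all finite compatible subsets have joins (for the empty set
this provides the zero), and multiplication distributes over these joins. -/
class DistributiveInverseSemigroup (S : Type u) extends InverseSemigroup S where
  exists_join : ∀ A : Set S, A.Finite → CompatibleSet A → ∃ s, IsLUB A s
  mul_join : ∀ (A : Set S) (s c : S), A.Finite → CompatibleSet A → IsLUB A s →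
    IsLUB ((fun a => c * a) '' A) (c * s)
  join_mul : ∀ (A : Set S) (s c : S), A.Finite → CompatibleSet A → IsLUB A s →
    IsLUB ((fun a => a * c) '' A) (s * c)

/-! ### Filters -/

section Filters

variable {P : Type u} [PartialOrder P]

/-- A proper filter: a nonempty, down-directed, upward closed subset that does not contain the
zero (the least element). -/
def IsProperFilter (F : Set P) : Prop :=
  Order.IsPFilter F ∧ ∀ z, IsBot z → z ∉ F

/-- A prime filter: a proper filter such that `a ∨ b ∈ F` implies `a ∈ F` or `b ∈ F`, whenever the
join exists. (In an inverse semigroup two elements with an upper bound are compatible, so the joins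
here are joins of compatible pairs.) -/
def IsPrimeFilter (F : Set P) : Prop :=
  IsProperFilter F ∧ ∀ a b c : P, IsLUB {a, b} c → c ∈ F → a ∈ F ∨ b ∈ F

/-- A completely prime filter: a proper filter such that `⋁ A ∈ F` implies `a ∈ F` for some
`a ∈ A`, whenever the join exists. (In an inverse semigroup every set with an upper bound is
compatible, so the joins here are joins of compatible sets.) -/
def IsCompletelyPrimeFilter (F : Set P) : Prop :=
  IsProperFilter F ∧ ∀ (A : Set P) (s : P), IsLUB A s → s ∈ F → ∃ a ∈ A, a ∈ F

end Filters

/-! ### The category of distributive inverse semigroups and callitic morphisms -/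

/-- A callitic morphism of distributive inverse semigroups: a semigroup homomorphism that preserves
joins of finite compatible subsets and satisfies the conditions (DC1) and (DC2). -/
@[ext]
structure CalliticHom (S : Type u) (T : Type v) [DistributiveInverseSemigroup S]
    [DistributiveInverseSemigroup T] where
  toFun : S → T
  map_mul : ∀ a b, toFun (a * b) = toFun a * toFun b
  map_join : ∀ (A : Set S) (s : S), A.Finite → CompatibleSet A → IsLUB A s →
    IsLUB (toFun '' A) (toFun s)
  dc1 : ∀ (s₁ s₂ : S) (t : T), t ≤ toFun s₁ → t ≤ toFun s₂ →
    ∃ s, s ≤ s₁ ∧ s ≤ s₂ ∧ t ≤ toFun s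
  dc2 : ∀ F : Set T, IsPrimeFilter F → (toFun ⁻¹' F).Nonempty

namespace CalliticHom

section Lemmas

variable {S : Type u} {T : Type v} {R : Type w} [DistributiveInverseSemigroup S]
  [DistributiveInverseSemigroup T] [DistributiveInverseSemigroup R]

theorem map_inv (f : CalliticHom S T) (s : S) : f.toFun s⁻¹ = (f.toFun s)⁻¹ := by
  apply InverseSemigroup.inv_unique
  · rw [← f.map_mul, ← f.map_mul, InverseSemigroup.mul_inv_mul]
  · rw [← f.map_mul, ← f.map_mul, InverseSemigroup.inv_mul_inv]

theorem map_compatibleSet (f : CalliticHom S T) {A : Set S} (hA : CompatibleSet A) :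
    CompatibleSet (f.toFun '' A) := by
  rintro _ ⟨a, ha, rfl⟩ _ ⟨b, hb, rfl⟩
  obtain ⟨h1, h2⟩ := hA a ha b hb
  constructor
  · have := congrArg f.toFun h1
    rwa [f.map_mul, f.map_mul, f.map_inv] at this
  · have := congrArg f.toFun h2
    rwa [f.map_mul, f.map_mul, f.map_inv] at this

theorem map_le (f : CalliticHom S T) {a b : S} (h : a ≤ b) : f.toFun a ≤ f.toFun b := by
  obtain ⟨e, he, rfl⟩ := h
  exact ⟨f.toFun e, by rw [← f.map_mul, he], f.map_mul _ _⟩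

theorem le_compatible {a b c : S} (ha : a ≤ c) (hb : b ≤ c) : Compatible a b := by
  have key : ∀ x : S, (x⁻¹ * x) * (x⁻¹ * x) = x⁻¹ * x := fun x => by
    rw [← mul_assoc, InverseSemigroup.inv_mul_inv]
  have key2 : ∀ x : S, (x * x⁻¹) * (x * x⁻¹) = x * x⁻¹ := fun x => by
    rw [← mul_assoc, InverseSemigroup.mul_inv_mul]
  have inv_mul_e : ∀ (x e : S), e * e = e → (x * e)⁻¹ = e * x⁻¹ := fun x e he => by
    symm
    apply InverseSemigroup.inv_unique
    · calc x * e * (e * x⁻¹) * (x * e) = x * ((e * e) * (x⁻¹ * x)) * e := by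
            simp only [mul_assoc]
        _ = x * ((x⁻¹ * x) * e) * e := by rw [he, idem_comm he (key x)]
        _ = (x * x⁻¹ * x) * (e * e) := by simp only [mul_assoc]
        _ = x * e := by rw [he, InverseSemigroup.mul_inv_mul]
    · calc e * x⁻¹ * (x * e) * (e * x⁻¹) = e * ((x⁻¹ * x) * (e * e)) * x⁻¹ := by
            simp only [mul_assoc]
        _ = e * (e * (x⁻¹ * x)) * x⁻¹ := by rw [he, idem_comm he (key x)]
        _ = (e * e) * (x⁻¹ * x * x⁻¹) := by simp only [mul_assoc]
        _ = e * x⁻¹ := by rw [he, InverseSemigroup.inv_mul_inv]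
  obtain ⟨e, he, rfl⟩ := ha
  obtain ⟨f, hf, rfl⟩ := hb
  constructor
  · have : (c * e)⁻¹ * (c * f) = e * (c⁻¹ * c) * f := by
      rw [inv_mul_e c e he]; simp only [mul_assoc]
    rw [this]
    exact idem_mul_idem (idem_mul_idem he (key c)) hf
  · have hef := idem_mul_idem he hf
    have h1 : c * e * (c * f)⁻¹ = c * (e * f) * (c * (e * f))⁻¹ := by
      rw [inv_mul_e c f hf, inv_mul_e c _ hef]
      calc c * e * (f * c⁻¹) = c * (e * f) * c⁻¹ := by simp only [mul_assoc]
        _ = c * ((e * f) * (e * f)) * c⁻¹ := by rw [hef]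
        _ = c * (e * f) * (e * f * c⁻¹) := by simp only [mul_assoc]
    rw [h1]
    exact key2 _

/-- Inverse images of prime filters under callitic morphisms are prime filters. -/
theorem preimage_isPrimeFilter (f : CalliticHom S T) {F : Set T} (hF : IsPrimeFilter F) :
    IsPrimeFilter (f.toFun ⁻¹' F) := by
  obtain ⟨⟨hP, h0⟩, hprime⟩ := hF
  refine ⟨⟨Order.IsPFilter.of_def (f.dc2 F ⟨⟨hP, h0⟩, hprime⟩) ?_ ?_, ?_⟩, ?_⟩
  · intro a ha b hb
    obtain ⟨t, ht, hta, htb⟩ := hP.toPFilter.directed _ ha _ hb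
    obtain ⟨s, hsa, hsb, hts⟩ := f.dc1 a b t hta htb
    exact ⟨s, hP.toPFilter.mem_of_le hts ht, hsa, hsb⟩
  · intro x y hxy hx
    exact hP.toPFilter.mem_of_le (f.map_le hxy) hx
  · intro z hz hzF
    refine h0 _ ?_ hzF
    have := f.map_join ∅ z Set.finite_empty (fun s hs => hs.elim) (isLUB_empty_iff.2 hz)
    rw [Set.image_empty] at this
    exact isLUB_empty_iff.1 this
  · intro a b c hc hcF
    refine hprime _ _ _ ?_ hcF
    have h := f.map_join {a, b} c (Set.toFinite _) (fun x hx y hy =>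
      le_compatible (hc.1 hx) (hc.1 hy)) hc
    rwa [Set.image_pair] at h

/-- The identity callitic morphism. -/
def id (S : Type u) [DistributiveInverseSemigroup S] : CalliticHom S S where
  toFun s := s
  map_mul _ _ := rfl
  map_join A s _ _ h := by simpa using h
  dc1 s₁ s₂ t h1 h2 := ⟨t, h1, h2, le_rfl⟩
  dc2 F hF := hF.1.1.toPFilter.nonempty

/-- The composite of two callitic morphisms. -/
def comp (g : CalliticHom T R) (f : CalliticHom S T) : CalliticHom S R where
  toFun s := g.toFun (f.toFun s)
  map_mul a b := by rw [f.map_mul, g.map_mul]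
  map_join A s hfin hA h := by
    have := g.map_join _ _ (hfin.image f.toFun) (f.map_compatibleSet hA) (f.map_join A s hfin hA h)
    rwa [Set.image_image] at this
  dc1 s₁ s₂ t h1 h2 := by
    obtain ⟨r, hr1, hr2, hr⟩ := g.dc1 _ _ t h1 h2
    obtain ⟨s, hs1, hs2, hs⟩ := f.dc1 s₁ s₂ r hr1 hr2
    exact ⟨s, hs1, hs2, hr.trans (g.map_le hs)⟩
  dc2 F hF := f.dc2 _ (g.preimage_isPrimeFilter hF)

end Lemmas

end CalliticHom

/-- The objects of the category of distributive inverse semigroups. -/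
structure DistInvSgp : Type (u + 1) where
  carrier : Type u
  [str : DistributiveInverseSemigroup carrier]

attribute [instance] DistInvSgp.str

/-- The category of distributive inverse semigroups and callitic morphisms. -/
instance : Category.{u} DistInvSgp.{u} where
  Hom S T := CalliticHom S.carrier T.carrier
  id S := CalliticHom.id S.carrier
  comp f g := CalliticHom.comp g f

/-! ### Groupoids -/

/-- A groupoid, in the single-sorted form: a set with an associative multiplication `mul x y`
defined for the composable pairs (those with `Comp x y`), and an involution `inv`. -/
class PartialGroupoid (G : Type u) where
  Comp : G → G → Prop
  mul : ∀ x y : G, Comp x y → G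
  inv : G → G
  inv_inv : ∀ x, inv (inv x) = x
  comp_mul_left : ∀ x y z (h : Comp x y), Comp y z → Comp (mul x y h) z
  comp_mul_right : ∀ x y z, Comp x y → ∀ k : Comp y z, Comp x (mul y z k)
  mul_assoc : ∀ x y z (h : Comp x y) (k : Comp y z),
    mul (mul x y h) z (comp_mul_left x y z h k) = mul x (mul y z k) (comp_mul_right x y z h k)
  inv_comp : ∀ x, Comp (inv x) x
  comp_inv : ∀ x, Comp x (inv x)
  inv_mul_cancel : ∀ x y (h : Comp x y),
    mul (inv x) (mul x y h) (comp_mul_right (inv x) x y (inv_comp x) h) = y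
  mul_inv_cancel : ∀ z x (h : Comp z x),
    mul (mul z x h) (inv x) (comp_mul_left z x (inv x) h (comp_inv x)) = z

section Groupoid

open PartialGroupoid

variable {G : Type u} [PartialGroupoid G]

/-- The domain `x⁻¹x` of `x`. -/
def dom (x : G) : G := mul (inv x) x (inv_comp x)

/-- The range `xx⁻¹` of `x`. -/
def ran (x : G) : G := mul x (inv x) (comp_inv x)

/-- The set `G_o` of identities, the elements of the form `xx⁻¹`. -/
def identities (G : Type u) [PartialGroupoid G] : Set G := Set.range ran

theorem mul_congr {x x' y y' : G} (hx : x = x') (hy : y = y') (h : Comp x y) (h' : Comp x' y') :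
    mul x y h = mul x' y' h' := by
  subst hx hy; rfl

theorem dom_mem (x : G) : dom x ∈ identities G :=
  ⟨inv x, mul_congr rfl (inv_inv x) _ _⟩

/-- The domain map, from the groupoid to its set of identities. -/
def domMap (x : G) : identities G := ⟨dom x, dom_mem x⟩

/-- The product of two subsets. -/
def setMul (A B : Set G) : Set G :=
  {z | ∃ x ∈ A, ∃ y ∈ B, ∃ h : Comp x y, mul x y h = z}

/-- The set of inverses of the elements of a subset. -/
def setInv (A : Set G) : Set G := inv '' A

/-- A (local) bisection: a subset `A` such that `A⁻¹A` and `AA⁻¹` consist of identities. -/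
def IsBisection (A : Set G) : Prop :=
  setMul (setInv A) A ⊆ identities G ∧ setMul A (setInv A) ⊆ identities G

theorem comp_dom (x : G) : Comp x (dom x) := comp_mul_right _ _ _ (comp_inv x) _

theorem mul_dom (x : G) : mul x (dom x) (comp_dom x) = x := by
  have h := inv_mul_cancel (inv x) x (inv_comp x)
  exact (mul_congr (inv_inv x).symm rfl _ _).trans h

theorem identity_idem {e : G} (he : e ∈ identities G) : ∃ h : Comp e e, mul e e h = e := by
  obtain ⟨x, rfl⟩ := he
  have h1 : Comp (ran x) x := comp_mul_left _ _ _ (comp_inv x) (inv_comp x)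
  have h2 : mul (ran x) x h1 = x := by
    have h := mul_inv_cancel x (inv x) (comp_inv x)
    exact (mul_congr rfl (inv_inv x).symm _ _).trans h
  have h3 : Comp (ran x) (ran x) := comp_mul_right _ _ _ h1 (comp_inv x)
  refine ⟨h3, ?_⟩
  have h4 := mul_assoc (ran x) x (inv x) h1 (comp_inv x)
  exact h4.symm.trans (mul_congr h2 rfl _ _)

theorem idem_identity {e : G} (h : Comp e e) (he : mul e e h = e) : e ∈ identities G := by
  have h1 := inv_mul_cancel e e h
  have h2 : dom e = e := (mul_congr rfl he.symm _ _).trans h1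
  rw [← h2]
  exact dom_mem e

end Groupoid

section Topology

open PartialGroupoid

variable (G : Type u) [TopologicalSpace G] [PartialGroupoid G]

/-- An étale groupoid: a groupoid with a topology such that inversion and multiplication (on the
space of composable pairs) are continuous and such that the domain map, from the groupoid to its
space of identities, is a local homeomorphism. -/
structure IsEtale : Prop where
  continuous_inv : Continuous (inv : G → G)
  continuous_mul : Continuous (fun p : {p : G × G // Comp p.1 p.2} => mul p.1.1 p.1.2 p.2)
  isLocalHomeomorph_dom : IsLocalHomeomorph (domMap : G → identities G)

/-- The set `B(G)` of open bisections. -/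
def OpenBisection : Type u := {A : Set G // IsOpen A ∧ IsBisection A}

/-- Open bisections are ordered by inclusion. This is the natural partial order of the inverse
semigroup of open bisections of an étale groupoid under subset multiplication. -/
instance : PartialOrder (OpenBisection G) :=
  inferInstanceAs (PartialOrder {A : Set G // IsOpen A ∧ IsBisection A})

/-- The space `G(B(G))` of completely prime filters of open bisections. -/
def BisectionSpectrum : Type u := {F : Set (OpenBisection G) // IsCompletelyPrimeFilter F}

/-- The topology on `G(B(G))` has as basis the sets `X_U` of all completely prime filters that
contain the open bisection `U`. -/
instance : TopologicalSpace (BisectionSpectrum G) :=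
  TopologicalSpace.generateFrom
    (Set.range fun U : OpenBisection G => {F : BisectionSpectrum G | U ∈ F.1})

/-- A groupoid with a topology is sober if `g ↦ F_g = {U | g ∈ U}` is a homeomorphism from `G` to
the space of completely prime filters of open bisections. -/
def IsSober : Prop :=
  ∃ η : G ≃ₜ BisectionSpectrum G, ∀ g : G, (η g).1 = {U : OpenBisection G | g ∈ U.1}

/-- The set `KB(G)` of compact-open bisections. -/
def compactOpenBisections : Set (Set G) := {A | IsCompact A ∧ IsOpen A ∧ IsBisection A}

/-- A coherent étale groupoid. -/
structure IsCoherentEtale : Prop where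
  etale : IsEtale G
  isBasis : TopologicalSpace.IsTopologicalBasis (compactOpenBisections G)
  mul_mem : ∀ A ∈ compactOpenBisections G, ∀ B ∈ compactOpenBisections G,
    setMul A B ∈ compactOpenBisections G
  sober : IsSober G

end Topology

/-! ### The category of coherent étale groupoids -/

/-- A coherent continuous covering functor between groupoids with topologies. Coherence means that
inverse images of compact-open sets are compact-open. -/
@[ext]
structure CoherentCovering (G : Type u) (H : Type v) [TopologicalSpace G] [PartialGroupoid G]
    [TopologicalSpace H] [PartialGroupoid H] where
  toFun : G → H
  map_comp : ∀ x y, PartialGroupoid.Comp x y → PartialGroupoid.Comp (toFun x) (toFun y)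
  map_mul : ∀ x y (h : PartialGroupoid.Comp x y),
    toFun (PartialGroupoid.mul x y h) =
      PartialGroupoid.mul (toFun x) (toFun y) (map_comp x y h)
  continuous_toFun : Continuous toFun
  cover_inj : ∀ g g' : G, dom g = dom g' → toFun g = toFun g' → g = g'
  cover_surj : ∀ e ∈ identities G, ∀ h : H, toFun e = dom h → ∃ g : G, dom g = e ∧ toFun g = h
  coherent : ∀ X : Set H, IsCompact X → IsOpen X →
    IsCompact (toFun ⁻¹' X) ∧ IsOpen (toFun ⁻¹' X)

namespace CoherentCovering

section Lemmas

open PartialGroupoid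

variable {G : Type u} {H : Type v} {K : Type w} [TopologicalSpace G] [PartialGroupoid G]
  [TopologicalSpace H] [PartialGroupoid H] [TopologicalSpace K] [PartialGroupoid K]

theorem map_identity (f : CoherentCovering G H) {e : G} (he : e ∈ identities G) :
    f.toFun e ∈ identities H := by
  obtain ⟨h, hh⟩ := identity_idem he
  exact idem_identity (f.map_comp e e h) (by rw [← f.map_mul e e h, hh])

theorem map_dom (f : CoherentCovering G H) (g : G) : f.toFun (dom g) = dom (f.toFun g) := by
  have h1 : Comp (f.toFun g) (f.toFun (dom g)) := f.map_comp _ _ (comp_dom g)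
  have h2 : mul (f.toFun g) (f.toFun (dom g)) h1 = f.toFun g := by
    rw [← f.map_mul _ _ (comp_dom g), mul_dom]
  have h3 := inv_mul_cancel _ _ h1
  exact h3.symm.trans (mul_congr rfl h2 _ _)

/-- The identity functor. -/
def id (G : Type u) [TopologicalSpace G] [PartialGroupoid G] : CoherentCovering G G where
  toFun g := g
  map_comp _ _ h := h
  map_mul _ _ _ := rfl
  continuous_toFun := continuous_id
  cover_inj _ _ _ h := h
  cover_surj _ _ h hh := ⟨h, hh.symm, rfl⟩
  coherent _ h1 h2 := ⟨h1, h2⟩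

/-- The composite of two coherent continuous covering functors. -/
def comp (g : CoherentCovering H K) (f : CoherentCovering G H) : CoherentCovering G K where
  toFun x := g.toFun (f.toFun x)
  map_comp x y h := g.map_comp _ _ (f.map_comp x y h)
  map_mul x y h := by rw [← g.map_mul _ _ (f.map_comp x y h), ← f.map_mul x y h]
  continuous_toFun := g.continuous_toFun.comp f.continuous_toFun
  cover_inj x y hd h := by
    refine f.cover_inj x y hd (g.cover_inj _ _ ?_ h)
    rw [← f.map_dom, ← f.map_dom, hd]
  cover_surj e he k hk := by
    obtain ⟨h, hd, hh⟩ := g.cover_surj (f.toFun e) (f.map_identity he) k hk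
    obtain ⟨x, hx, hxh⟩ := f.cover_surj e he h hd.symm
    exact ⟨x, hx, by rw [hxh, hh]⟩
  coherent X h1 h2 := by
    obtain ⟨h3, h4⟩ := g.coherent X h1 h2
    exact f.coherent _ h3 h4

end Lemmas

end CoherentCovering

/-- The objects of the category of coherent étale groupoids. -/
structure CohEtaleGpd : Type (u + 1) where
  carrier : Type u
  [top : TopologicalSpace carrier]
  [gpd : PartialGroupoid carrier]
  isCoherentEtale : IsCoherentEtale carrier

attribute [instance] CohEtaleGpd.top CohEtaleGpd.gpd

/-- The category of coherent étale groupoids and coherent continuous covering functors. -/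
instance : Category.{u} CohEtaleGpd.{u} where
  Hom G H := CoherentCovering G.carrier H.carrier
  id G := CoherentCovering.id G.carrier
  comp f g := CoherentCovering.comp g f

end NCStone

/-!
The duality sends a coherent étale groupoid `G` to the inverse semigroup `KB G` of its compact-open
bisections, whose natural partial order is inclusion and whose finite joins are unions, and a
coherent covering functor to the inverse image map. The resulting contravariant functor
`bisectionFunctor` is shown to be faithful, full and essentially surjective.

Sobriety enters through `KB.exists_point` and `KB.point_ext`: the points of `G` are exactly the
prime filters of `KB G`. A prime filter of compact-open bisections generates a completely prime
filter of open bisections because its members are compact. Faithfulness follows, since a covering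
functor is determined by the neighbourhoods of its values. For fullness, a callitic morphism
`θ : KB H → KB G` pulls the prime filter of a point `g` of `G` back to a prime filter of `KB H`,
which is that of a unique point `KB.pointMap θ g` of `H`. Functoriality and the covering property
are read off from the defining equivalence `KB.pointMap_mem`, because domains and products of points
can be tested against compact-open bisections (`KB.mem_mul_iff_dom_mem`, `KB.mem_inv_mul_iff`).

For essential surjectivity, a distributive inverse semigroup `S` is recovered from its groupoid
`Spec S` of prime filters. The prime filter theorem `exists_isPrimeFilter` shows that the basic sets
`Spec.basic s`, of all prime filters containing `s`, determine `s` and are compact. They are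
bisections and satisfy `Spec.setMul_basic`. An element all of whose prime filters are identities is
idempotent (`Spec.idem_of_basic_subset`), so finitely many basic sets inside a bisection come from
compatible elements and their union is again basic. Hence `s ↦ Spec.basic s` is an isomorphism from
`S` onto `KB (Spec S)`.
-/

namespace NCStone

/-! ### The natural partial order of an inverse semigroup -/

namespace InverseSemigroup

variable {S : Type u} [InverseSemigroup S]

theorem inv_inv_self (a : S) : a⁻¹⁻¹ = a := (inv_inv_eq a).symm

theorem idem_inv_mul (a : S) : a⁻¹ * a * (a⁻¹ * a) = a⁻¹ * a := by
  rw [← mul_assoc, inv_mul_inv]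

theorem idem_mul_inv (a : S) : a * a⁻¹ * (a * a⁻¹) = a * a⁻¹ := by
  rw [← mul_assoc, mul_inv_mul]

theorem inv_idem {e : S} (he : e * e = e) : e⁻¹ = e := (idem_eq_inv he).symm

theorem inv_of_mul (a b : S) : (a * b)⁻¹ = b⁻¹ * a⁻¹ := by
  symm
  have hc : b * b⁻¹ * (a⁻¹ * a) = a⁻¹ * a * (b * b⁻¹) :=
    idem_comm (idem_mul_inv b) (idem_inv_mul a)
  apply inv_unique
  · calc a * b * (b⁻¹ * a⁻¹) * (a * b) = a * (b * b⁻¹ * (a⁻¹ * a)) * b := by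
          simp only [mul_assoc]
      _ = (a * a⁻¹ * a) * (b * b⁻¹ * b) := by rw [hc]; simp only [mul_assoc]
      _ = a * b := by rw [mul_inv_mul, mul_inv_mul]
  · calc b⁻¹ * a⁻¹ * (a * b) * (b⁻¹ * a⁻¹) = b⁻¹ * (a⁻¹ * a * (b * b⁻¹)) * a⁻¹ := by
          simp only [mul_assoc]
      _ = (b⁻¹ * b * b⁻¹) * (a⁻¹ * a * a⁻¹) := by rw [← hc]; simp only [mul_assoc]
      _ = b⁻¹ * a⁻¹ := by rw [inv_mul_inv, inv_mul_inv]

theorem mul_idem_le (a : S) {e : S} (he : e * e = e) : a * e ≤ a := ⟨e, he, rfl⟩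

theorem conj_idem (a : S) {e : S} (he : e * e = e) :
    a * e * a⁻¹ * (a * e * a⁻¹) = a * e * a⁻¹ := by
  calc a * e * a⁻¹ * (a * e * a⁻¹) = a * (e * (a⁻¹ * a)) * e * a⁻¹ := by simp only [mul_assoc]
    _ = (a * a⁻¹ * a) * (e * e) * a⁻¹ := by
      rw [idem_comm he (idem_inv_mul a)]; simp only [mul_assoc]
    _ = a * e * a⁻¹ := by rw [he, mul_inv_mul]

theorem mul_idem_eq (a : S) {e : S} (he : e * e = e) : a * e = a * e * a⁻¹ * a := by
  calc a * e = (a * a⁻¹ * a) * e := by rw [mul_inv_mul]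
    _ = a * ((a⁻¹ * a) * e) := by simp only [mul_assoc]
    _ = a * e * a⁻¹ * a := by rw [idem_comm (idem_inv_mul a) he]; simp only [mul_assoc]

theorem idem_mul_le (a : S) {e : S} (he : e * e = e) : e * a ≤ a := by
  refine ⟨a⁻¹ * e * a, ?_, ?_⟩
  · have := conj_idem a⁻¹ he
    rwa [inv_inv_self] at this
  · calc e * a = e * (a * a⁻¹ * a) := by rw [mul_inv_mul]
      _ = (e * (a * a⁻¹)) * a := by simp only [mul_assoc]
      _ = a * (a⁻¹ * e * a) := by rw [idem_comm he (idem_mul_inv a)]; simp only [mul_assoc]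

theorem le_iff_left {a b : S} : a ≤ b ↔ ∃ e : S, e * e = e ∧ a = e * b := by
  constructor
  · rintro ⟨e, he, rfl⟩
    exact ⟨b * e * b⁻¹, conj_idem b he, mul_idem_eq b he⟩
  · rintro ⟨e, he, rfl⟩
    exact idem_mul_le b he

theorem mul_le_mul {a b c d : S} (h₁ : a ≤ b) (h₂ : c ≤ d) : a * c ≤ b * d := by
  obtain ⟨e, he, rfl⟩ := le_iff_left.1 h₁
  obtain ⟨f, hf, rfl⟩ := h₂
  calc e * b * (d * f) = e * (b * d) * f := by simp only [mul_assoc]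
    _ ≤ e * (b * d) := mul_idem_le _ hf
    _ ≤ b * d := idem_mul_le _ he

theorem inv_le_inv {a b : S} (h : a ≤ b) : a⁻¹ ≤ b⁻¹ := by
  obtain ⟨e, he, rfl⟩ := h
  rw [inv_of_mul, inv_idem he]
  exact idem_mul_le _ he

theorem inv_le_comm {a b : S} : a⁻¹ ≤ b ↔ a ≤ b⁻¹ :=
  ⟨fun h => by simpa only [inv_inv_self] using inv_le_inv h,
    fun h => by simpa only [inv_inv_self] using inv_le_inv h⟩

theorem idem_of_le {a e : S} (h : a ≤ e) (he : e * e = e) : a * a = a := by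
  obtain ⟨f, hf, rfl⟩ := h
  exact idem_mul_idem he hf

theorem mul_inv_mul_le (a s : S) : a * (a⁻¹ * s) ≤ s := by
  rw [← mul_assoc]
  exact idem_mul_le s (idem_mul_inv a)

/-- If `b ≤ a` then `b` is the restriction of `a` to the domain of `b`. -/
theorem mul_inv_mul_of_le {a b : S} (h : b ≤ a) : a * (b⁻¹ * b) = b := by
  obtain ⟨e, he, rfl⟩ := h
  rw [inv_of_mul, inv_idem he]
  calc a * (e * a⁻¹ * (a * e)) = a * (e * (a⁻¹ * a)) * e := by simp only [mul_assoc]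
    _ = (a * a⁻¹ * a) * (e * e) := by
      rw [idem_comm he (idem_inv_mul a)]; simp only [mul_assoc]
    _ = a * e := by rw [he, mul_inv_mul]

end InverseSemigroup

/-! ### Prime filters in distributive inverse semigroups -/

section PrimeFilter

open InverseSemigroup

variable {S : Type u} [DistributiveInverseSemigroup S]

/-- Elements with a join are bounded above and hence compatible. -/
theorem compatibleSet_pair {a b c : S} (h : IsLUB {a, b} c) : CompatibleSet {a, b} :=
  fun _ hx _ hy => CalliticHom.le_compatible (h.1 hx) (h.1 hy)

theorem isLUB_mul_left {a b c : S} (h : IsLUB {a, b} c) (x : S) :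
    IsLUB {x * a, x * b} (x * c) := by
  have := DistributiveInverseSemigroup.mul_join {a, b} c x (Set.toFinite _)
    (compatibleSet_pair h) h
  rwa [Set.image_pair] at this

theorem isLUB_mul_right {a b c : S} (h : IsLUB {a, b} c) (x : S) :
    IsLUB {a * x, b * x} (c * x) := by
  have := DistributiveInverseSemigroup.join_mul {a, b} c x (Set.toFinite _)
    (compatibleSet_pair h) h
  rwa [Set.image_pair] at this

theorem isLUB_inv {a b c : S} (h : IsLUB {a, b} c) : IsLUB {a⁻¹, b⁻¹} c⁻¹ := by
  rw [isLUB_iff_le_iff] at h ⊢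
  intro d
  rw [inv_le_comm, h d⁻¹]
  simp only [mem_upperBounds, Set.mem_insert_iff, Set.mem_singleton_iff, forall_eq_or_imp,
    forall_eq, inv_le_comm]

theorem exists_isBot (S : Type u) [DistributiveInverseSemigroup S] : ∃ z : S, IsBot z := by
  obtain ⟨z, hz⟩ := DistributiveInverseSemigroup.exists_join (∅ : Set S) Set.finite_empty
    (fun s hs => hs.elim)
  exact ⟨z, isLUB_empty_iff.1 hz⟩

theorem isBot_mul_left {z : S} (hz : IsBot z) (x : S) : IsBot (x * z) := by
  have := DistributiveInverseSemigroup.mul_join ∅ z x Set.finite_empty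
    (fun s hs => hs.elim) (isLUB_empty_iff.2 hz)
  rw [Set.image_empty] at this
  exact isLUB_empty_iff.1 this

theorem isBot_inv {z : S} (hz : IsBot z) : IsBot z⁻¹ := fun a => inv_le_comm.2 (hz a⁻¹)

namespace IsPrimeFilter

variable {F : Set S}

theorem mem_of_le (hF : IsPrimeFilter F) {a b : S} (h : a ≤ b) (ha : a ∈ F) : b ∈ F :=
  hF.1.1.toPFilter.mem_of_le h ha

theorem exists_le_le (hF : IsPrimeFilter F) {a b : S} (ha : a ∈ F) (hb : b ∈ F) :
    ∃ c ∈ F, c ≤ a ∧ c ≤ b :=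
  hF.1.1.toPFilter.directed a ha b hb

theorem nonempty (hF : IsPrimeFilter F) : F.Nonempty := hF.1.1.toPFilter.nonempty

/-- The properties of a prime filter in elementary form. -/
theorem mk' (h₁ : F.Nonempty) (h₂ : ∀ a ∈ F, ∀ b ∈ F, ∃ c ∈ F, c ≤ a ∧ c ≤ b)
    (h₃ : ∀ a b : S, a ≤ b → a ∈ F → b ∈ F) (h₄ : ∀ z, IsBot z → z ∉ F)
    (h₅ : ∀ a b c : S, IsLUB {a, b} c → c ∈ F → a ∈ F ∨ b ∈ F) : IsPrimeFilter F :=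
  ⟨⟨Order.IsPFilter.of_def h₁ h₂ fun {a b} => h₃ a b, h₄⟩, h₅⟩

/-- A prime filter that contains the join of a finite set meets the set. -/
theorem exists_mem_of_isLUB (hF : IsPrimeFilter F) {A : Set S} (hfin : A.Finite) :
    ∀ {s : S}, IsLUB A s → s ∈ F → ∃ a ∈ A, a ∈ F := by
  induction A, hfin using Set.Finite.induction_on with
  | empty => exact fun {s} h hs => (hF.1.2 s (isLUB_empty_iff.1 h) hs).elim
  | @insert b A _ hfin ih =>
    intro s h hs
    obtain ⟨r, hr⟩ := DistributiveInverseSemigroup.exists_join A hfin fun x hx y hy =>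
      CalliticHom.le_compatible (h.1 (Set.mem_insert_of_mem _ hx))
        (h.1 (Set.mem_insert_of_mem _ hy))
    have hlub : IsLUB {b, r} s := by
      rw [isLUB_iff_le_iff] at h ⊢
      intro d
      rw [h d, upperBounds_insert, upperBounds_insert, upperBounds_singleton]
      exact and_congr_right fun _ => (isLUB_le_iff hr).symm
    rcases hF.2 b r s hlub hs with hb | hrF
    · exact ⟨b, Set.mem_insert _ _, hb⟩
    · obtain ⟨a, ha, haF⟩ := ih hr hrF
      exact ⟨a, Set.mem_insert_of_mem _ ha, haF⟩

end IsPrimeFilter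

/-- The prime filter theorem: an element outside a lower set that is closed under binary joins is
contained in a prime filter that misses the lower set. A filter maximal among those that contain
the element and miss the lower set is prime. -/
theorem exists_isPrimeFilter {I : Set S} (hI : IsLowerSet I) (h₀ : I.Nonempty)
    (hjoin : ∀ a b c : S, IsLUB {a, b} c → a ∈ I → b ∈ I → c ∈ I) {s : S} (hs : s ∉ I) :
    ∃ F : Set S, IsPrimeFilter F ∧ s ∈ F ∧ Disjoint F I := by
  let 𝓢 : Set (Set S) := {F | Order.IsPFilter F ∧ Disjoint F I}
  have hchain : ∀ c ⊆ 𝓢, IsChain (· ⊆ ·) c → c.Nonempty → ∃ ub ∈ 𝓢, ∀ F ∈ c, F ⊆ ub := by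
    intro c hc hchain ⟨F₀, hF₀⟩
    refine ⟨⋃₀ c, ⟨Order.IsPFilter.of_def ?_ ?_ ?_, ?_⟩, fun F hF => Set.subset_sUnion_of_mem hF⟩
    · obtain ⟨x, hx⟩ := (hc hF₀).1.toPFilter.nonempty
      exact ⟨x, F₀, hF₀, hx⟩
    · rintro a ⟨F, hF, ha⟩ b ⟨F', hF', hb⟩
      have key : ∀ F ∈ c, a ∈ F → b ∈ F → ∃ x ∈ ⋃₀ c, x ≤ a ∧ x ≤ b := fun F hF ha hb => by
        obtain ⟨x, hx, h⟩ := (hc hF).1.toPFilter.directed a ha b hb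
        exact ⟨x, ⟨F, hF, hx⟩, h⟩
      rcases hchain.total hF hF' with h | h
      · exact key F' hF' (h ha) hb
      · exact key F hF ha (h hb)
    · rintro a b hab ⟨F, hF, ha⟩
      exact ⟨F, hF, (hc hF).1.toPFilter.mem_of_le hab ha⟩
    · exact Set.disjoint_sUnion_left.2 fun F hF => (hc hF).2
  have hprincipal : Set.Ici s ∈ 𝓢 := by
    refine ⟨Order.IsPFilter.of_def ⟨s, Set.mem_Ici.2 le_rfl⟩
      (fun a ha b hb => ⟨s, Set.mem_Ici.2 le_rfl, ha, hb⟩)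
      (fun {a b} hab ha => le_trans ha hab), ?_⟩
    exact Set.disjoint_left.2 fun x hx hxI => hs (hI hx hxI)
  obtain ⟨F, hsF, hmax⟩ := zorn_subset_nonempty 𝓢 hchain _ hprincipal
  obtain ⟨hF, hFI⟩ := hmax.prop
  refine ⟨F, ⟨⟨hF, ?_⟩, ?_⟩, hsF (Set.mem_Ici.2 le_rfl), hFI⟩
  · intro z hz hzF
    obtain ⟨i, hi⟩ := h₀
    exact Set.disjoint_left.1 hFI hzF (hI (hz i) hi)
  · intro a b c hc hcF
    -- For `a ≤ c` with `a ∉ F`, the filter generated by `F` and `a` meets `I`; it is generated by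
    -- the elements `a * (f⁻¹ * f)`, the meets of `a` with the elements `f ≤ c` of `F`.
    have key : ∀ a ≤ c, a ∉ F → ∃ f ∈ F, f ≤ c ∧ a * (f⁻¹ * f) ∈ I := by
      intro a hac haF
      by_contra! hcon
      let F' : Set S := {x | ∃ f ∈ F, f ≤ c ∧ a * (f⁻¹ * f) ≤ x}
      have hF' : F' ∈ 𝓢 := by
        refine ⟨Order.IsPFilter.of_def ⟨_, c, hcF, le_rfl, le_rfl⟩ ?_ ?_, ?_⟩
        · rintro x ⟨f, hf, hfc, hx⟩ y ⟨g, hg, hgc, hy⟩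
          obtain ⟨k, hk, hkf, hkg⟩ := hF.toPFilter.directed f hf g hg
          have hmono : ∀ {f : S}, k ≤ f → a * (k⁻¹ * k) ≤ a * (f⁻¹ * f) := fun h =>
            mul_le_mul le_rfl (mul_le_mul (inv_le_inv h) h)
          exact ⟨_, ⟨k, hk, hkf.trans hfc, le_rfl⟩, (hmono hkf).trans hx, (hmono hkg).trans hy⟩
        · rintro x y hxy ⟨f, hf, hfc, hx⟩
          exact ⟨f, hf, hfc, hx.trans hxy⟩
        · exact Set.disjoint_left.2 fun x ⟨f, hf, hfc, hx⟩ hxI => hcon f hf hfc (hI hx hxI)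
      have hsub : F ⊆ F' := by
        intro f hf
        obtain ⟨k, hk, hkf, hkc⟩ := hF.toPFilter.directed f hf c hcF
        refine ⟨k, hk, hkc, ?_⟩
        calc a * (k⁻¹ * k) ≤ c * (k⁻¹ * k) := mul_le_mul hac le_rfl
          _ = k := mul_inv_mul_of_le hkc
          _ ≤ f := hkf
      exact haF (hmax.le_of_ge hF' hsub ⟨c, hcF, le_rfl, mul_idem_le a (idem_inv_mul c)⟩)
    by_contra! hab
    obtain ⟨f, hf, hfc, hfI⟩ := key a (hc.1 (by simp)) hab.1
    obtain ⟨g, hg, hgc, hgI⟩ := key b (hc.1 (by simp)) hab.2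
    obtain ⟨k, hk, hkf, hkg⟩ := hF.toPFilter.directed f hf g hg
    have hmono : ∀ {f : S} (x : S), k ≤ f → x * (k⁻¹ * k) ≤ x * (f⁻¹ * f) := fun x h =>
      mul_le_mul le_rfl (mul_le_mul (inv_le_inv h) h)
    have hkI := hjoin _ _ _ (isLUB_mul_right hc (k⁻¹ * k)) (hI (hmono a hkf) hfI)
      (hI (hmono b hkg) hgI)
    rw [mul_inv_mul_of_le (hkf.trans hfc)] at hkI
    exact Set.disjoint_left.1 hFI hk hkI

/-- Prime filters determine the order. -/
theorem le_of_forall_isPrimeFilter {s t : S} (h : ∀ F, IsPrimeFilter F → s ∈ F → t ∈ F) :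
    s ≤ t := by
  by_contra hst
  obtain ⟨F, hF, hs, hdisj⟩ := exists_isPrimeFilter (I := Set.Iic t) (isLowerSet_Iic t)
    ⟨t, Set.mem_Iic.2 le_rfl⟩ (fun a b c hc ha hb => hc.2 (by
      rintro x (rfl | rfl)
      exacts [ha, hb])) hst
  exact Set.disjoint_left.1 hdisj (h F hF hs) (Set.mem_Iic.2 le_rfl)

end PrimeFilter

/-! ### Products in a groupoid as a ternary relation -/

section Groupoid

open PartialGroupoid

variable {G : Type u} [PartialGroupoid G]

/-- The graph of the partial multiplication: `x` and `y` are composable and their product is `z`.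
Working with this relation avoids transporting composability proofs along equalities. -/
def IsMul (x y z : G) : Prop := ∃ h : Comp x y, mul x y h = z

theorem IsMul.unique {x y z z' : G} (h : IsMul x y z) (h' : IsMul x y z') : z = z' := by
  obtain ⟨_, rfl⟩ := h
  obtain ⟨_, rfl⟩ := h'
  rfl

theorem IsMul.inv_left {x y z : G} (h : IsMul x y z) : IsMul (inv x) z y := by
  obtain ⟨h, rfl⟩ := h
  exact ⟨_, PartialGroupoid.inv_mul_cancel x y h⟩

theorem IsMul.inv_right {x y z : G} (h : IsMul x y z) : IsMul z (inv y) x := by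
  obtain ⟨h, rfl⟩ := h
  exact ⟨_, PartialGroupoid.mul_inv_cancel x y h⟩

theorem IsMul.inv_rev {x y z : G} (h : IsMul x y z) : IsMul (inv y) (inv x) (inv z) :=
  h.inv_left.inv_right.inv_left

theorem IsMul.assoc {x y z a w : G} (h₁ : IsMul x y a) (h₂ : IsMul a z w) :
    ∃ b, IsMul y z b ∧ IsMul x b w := by
  obtain ⟨hxy, rfl⟩ := h₁
  obtain ⟨haz, rfl⟩ := h₂
  have hyz : Comp y z := by
    have := comp_mul_left (inv x) (mul x y hxy) z (comp_mul_right _ _ _ (inv_comp x) hxy) haz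
    rwa [PartialGroupoid.inv_mul_cancel] at this
  exact ⟨_, ⟨hyz, rfl⟩, ⟨comp_mul_right _ _ _ hxy hyz,
    (PartialGroupoid.mul_assoc x y z hxy hyz).symm⟩⟩

theorem IsMul.assoc' {x y z b w : G} (h₁ : IsMul y z b) (h₂ : IsMul x b w) :
    ∃ a, IsMul x y a ∧ IsMul a z w := by
  obtain ⟨a, ha, ha'⟩ := h₁.inv_rev.assoc h₂.inv_rev
  refine ⟨inv a, ?_, ?_⟩
  · simpa only [PartialGroupoid.inv_inv] using ha.inv_rev
  · simpa only [PartialGroupoid.inv_inv] using ha'.inv_rev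

theorem isMul_inv_self (x : G) : IsMul (inv x) x (dom x) := ⟨_, rfl⟩

theorem isMul_self_inv (x : G) : IsMul x (inv x) (ran x) := ⟨_, rfl⟩

theorem isMul_dom (x : G) : IsMul x (dom x) x := ⟨_, mul_dom x⟩

theorem isMul_ran (x : G) : IsMul (ran x) x x := by
  simpa only [PartialGroupoid.inv_inv] using (isMul_self_inv x).inv_right

theorem mem_identities_iff {e : G} : e ∈ identities G ↔ IsMul e e e :=
  ⟨fun h => identity_idem h, fun ⟨h, he⟩ => idem_identity h he⟩

theorem ran_mem (x : G) : ran x ∈ identities G := ⟨x, rfl⟩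

theorem IsMul.eq_of_left {e x y : G} (h : IsMul e x y) (he : e ∈ identities G) : y = x := by
  obtain ⟨b, hb, hb'⟩ := (mem_identities_iff.1 he).assoc h
  cases h.unique hb
  exact hb'.inv_left.unique h.inv_left

theorem IsMul.eq_of_right {e x y : G} (h : IsMul x e y) (he : e ∈ identities G) : y = x := by
  obtain ⟨b, hb, hb'⟩ := (mem_identities_iff.1 he).assoc' h
  cases h.unique hb
  exact hb'.inv_right.unique h.inv_right

theorem dom_of_identity {e : G} (he : e ∈ identities G) : dom e = e :=
  (isMul_inv_self e).unique (mem_identities_iff.1 he).inv_left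

theorem inv_of_identity {e : G} (he : e ∈ identities G) : inv e = e := by
  have h := mem_identities_iff.1 he
  exact (h.inv_left.eq_of_left (mem_identities_iff.2 h.inv_rev) ▸
    h.inv_left.eq_of_right he).symm

theorem ran_inv (x : G) : ran (inv x) = dom x :=
  (isMul_self_inv (inv x)).unique (by simpa only [PartialGroupoid.inv_inv] using isMul_inv_self x)

theorem dom_inv (x : G) : dom (inv x) = ran x := by
  rw [← ran_inv, PartialGroupoid.inv_inv]

theorem ran_of_identity {e : G} (he : e ∈ identities G) : ran e = e := by
  rw [← dom_inv, inv_of_identity he, dom_of_identity he]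

theorem dom_dom (x : G) : dom (dom x) = dom x := dom_of_identity (dom_mem x)

theorem IsMul.dom_eq {x y z : G} (h : IsMul x y z) : dom z = dom y := by
  obtain ⟨a, ha, ha'⟩ := (isMul_dom z).assoc' h.inv_left
  cases h.inv_left.unique ha
  exact ha'.inv_left.unique (isMul_inv_self y)

theorem IsMul.ran_eq {x y z : G} (h : IsMul x y z) : ran z = ran x := by
  rw [← dom_inv, h.inv_rev.dom_eq, dom_inv]

theorem IsMul.dom_eq_ran {x y z : G} (h : IsMul x y z) : dom x = ran y := by
  rw [← ran_inv, ← h.inv_left.ran_eq]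

theorem exists_isMul {x y : G} (h : dom x = ran y) : ∃ z, IsMul x y z := by
  have h₁ : Comp x (ran y) := h ▸ (isMul_dom x).1
  have h₂ := comp_mul_left _ _ _ h₁ (isMul_ran y).1
  have h₃ : mul x (ran y) h₁ = x := IsMul.eq_of_right ⟨h₁, rfl⟩ (ran_mem y)
  exact ⟨_, h₃ ▸ h₂, rfl⟩

/-! ### Bisections -/

theorem mem_setMul {A B : Set G} {z : G} :
    z ∈ setMul A B ↔ ∃ x ∈ A, ∃ y ∈ B, IsMul x y z := Iff.rfl

theorem mem_setInv {A : Set G} {x : G} : x ∈ setInv A ↔ inv x ∈ A := by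
  constructor
  · rintro ⟨y, hy, rfl⟩
    rwa [PartialGroupoid.inv_inv]
  · exact fun h => ⟨inv x, h, PartialGroupoid.inv_inv x⟩

theorem setInv_eq_preimage (A : Set G) : setInv A = inv ⁻¹' A :=
  Set.ext fun _ => mem_setInv

theorem setInv_setInv (A : Set G) : setInv (setInv A) = A := by
  ext x
  rw [mem_setInv, mem_setInv, PartialGroupoid.inv_inv]

theorem setMul_mono {A A' B B' : Set G} (hA : A ⊆ A') (hB : B ⊆ B') :
    setMul A B ⊆ setMul A' B' := by
  rintro z ⟨x, hx, y, hy, h⟩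
  exact ⟨x, hA hx, y, hB hy, h⟩

theorem setMul_assoc (A B C : Set G) : setMul (setMul A B) C = setMul A (setMul B C) := by
  ext w
  constructor
  · rintro ⟨a, ⟨x, hx, y, hy, h₁⟩, z, hz, h₂⟩
    obtain ⟨b, hb, hb'⟩ := IsMul.assoc h₁ h₂
    exact ⟨x, hx, b, ⟨y, hy, z, hz, hb⟩, hb'⟩
  · rintro ⟨x, hx, b, ⟨y, hy, z, hz, h₁⟩, h₂⟩
    obtain ⟨a, ha, ha'⟩ := IsMul.assoc' h₁ h₂
    exact ⟨a, ⟨x, hx, y, hy, ha⟩, z, hz, ha'⟩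

theorem setInv_mul_subset_iff {A B : Set G} : setMul (setInv A) B ⊆ identities G ↔
    ∀ a ∈ A, ∀ b ∈ B, ran a = ran b → a = b := by
  constructor
  · intro h a ha b hb hab
    obtain ⟨z, hz⟩ := exists_isMul (x := inv a) (y := b) (by rw [dom_inv, hab])
    have hz' := hz.inv_left
    rw [PartialGroupoid.inv_inv] at hz'
    exact (hz'.eq_of_right (h ⟨_, ⟨a, ha, rfl⟩, b, hb, hz⟩)).symm
  · rintro h z ⟨_, ⟨a, ha, rfl⟩, b, hb, hz⟩
    have hz : IsMul (inv a) b z := hz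
    obtain rfl := h a ha b hb (by rw [← dom_inv, hz.dom_eq_ran])
    rw [hz.unique (isMul_inv_self a)]
    exact dom_mem a

theorem mul_setInv_subset_iff {A B : Set G} : setMul A (setInv B) ⊆ identities G ↔
    ∀ a ∈ A, ∀ b ∈ B, dom a = dom b → a = b := by
  constructor
  · intro h a ha b hb hab
    obtain ⟨z, hz⟩ := exists_isMul (x := a) (y := inv b) (by rw [ran_inv, hab])
    have hz' := hz.inv_right
    rw [PartialGroupoid.inv_inv] at hz'
    exact hz'.eq_of_left (h ⟨a, ha, _, ⟨b, hb, rfl⟩, hz⟩)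
  · rintro h z ⟨a, ha, _, ⟨b, hb, rfl⟩, hz⟩
    have hz : IsMul a (inv b) z := hz
    obtain rfl := h a ha b hb (by rw [hz.dom_eq_ran, ran_inv])
    rw [hz.unique (isMul_self_inv a)]
    exact ran_mem a

/-- A bisection is a set on which the domain and range maps are injective. -/
theorem isBisection_iff {A : Set G} : IsBisection A ↔
    (∀ a ∈ A, ∀ b ∈ A, ran a = ran b → a = b) ∧ ∀ a ∈ A, ∀ b ∈ A, dom a = dom b → a = b := by
  rw [IsBisection, setInv_mul_subset_iff, mul_setInv_subset_iff]

theorem IsBisection.eq_of_dom {A : Set G} (hA : IsBisection A) {a b : G} (ha : a ∈ A)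
    (hb : b ∈ A) (h : dom a = dom b) : a = b := (isBisection_iff.1 hA).2 a ha b hb h

theorem IsBisection.mono {A B : Set G} (hB : IsBisection B) (h : A ⊆ B) : IsBisection A := by
  rw [isBisection_iff] at hB ⊢
  exact ⟨fun a ha b hb => hB.1 a (h ha) b (h hb), fun a ha b hb => hB.2 a (h ha) b (h hb)⟩

theorem IsBisection.setInv {A : Set G} (hA : IsBisection A) : IsBisection (setInv A) :=
  ⟨by rw [setInv_setInv]; exact hA.2, by rw [setInv_setInv]; exact hA.1⟩

/-- An idempotent bisection consists of identities. -/
theorem IsBisection.subset_identities {A : Set G} (hA : IsBisection A) (h : setMul A A = A) :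
    A ⊆ identities G := by
  intro a ha
  obtain ⟨b, hb, c, hc, hbc⟩ := mem_setMul.1 (h.symm ▸ ha)
  obtain rfl := hA.eq_of_dom ha hc hbc.dom_eq
  obtain rfl := hbc.inv_right.unique (isMul_self_inv a)
  rw [(isBisection_iff.1 hA).1 a ha _ hb (ran_of_identity (ran_mem a)).symm]
  exact ran_mem a

theorem setMul_eq_left {A E : Set G} (hE : E ⊆ identities G) {x : G} (hx : x ∈ setMul A E) :
    x ∈ A ∧ dom x ∈ E := by
  obtain ⟨a, ha, e, he, h⟩ := mem_setMul.1 hx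
  obtain rfl := h.eq_of_right (hE he)
  refine ⟨ha, ?_⟩
  rwa [h.dom_eq_ran, ran_of_identity (hE he)]

end Groupoid

/-! ### The distributive inverse semigroup of compact-open bisections -/

section CompactOpenBisections

open PartialGroupoid

/-- The type of compact-open bisections of a coherent étale groupoid. The coherence hypothesis is
an argument so that the semigroup structure can be an instance. -/
def KB (G : Type u) [TopologicalSpace G] [PartialGroupoid G] (_ : IsCoherentEtale G) : Type u :=
  {A : Set G // A ∈ compactOpenBisections G}

namespace KB

variable {G : Type u} [TopologicalSpace G] [PartialGroupoid G] {hG : IsCoherentEtale G}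

theorem isCompact (A : KB G hG) : IsCompact A.1 := A.2.1

theorem isOpen (A : KB G hG) : IsOpen A.1 := A.2.2.1

theorem isBisection (A : KB G hG) : IsBisection A.1 := A.2.2.2

@[ext]
theorem ext {A B : KB G hG} (h : A.1 = B.1) : A = B := Subtype.ext h

theorem setInv_mem (hG : IsCoherentEtale G) {A : Set G} (hA : A ∈ compactOpenBisections G) :
    setInv A ∈ compactOpenBisections G := by
  refine ⟨hA.1.image hG.etale.continuous_inv, ?_, hA.2.2.setInv⟩
  rw [setInv_eq_preimage]
  exact hA.2.1.preimage hG.etale.continuous_inv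

instance : Mul (KB G hG) := ⟨fun A B => ⟨setMul A.1 B.1, hG.mul_mem _ A.2 _ B.2⟩⟩

instance : Inv (KB G hG) := ⟨fun A => ⟨setInv A.1, setInv_mem hG A.2⟩⟩

theorem mem_mul {A B : KB G hG} {z : G} :
    z ∈ (A * B).1 ↔ ∃ x ∈ A.1, ∃ y ∈ B.1, IsMul x y z := Iff.rfl

theorem mem_inv {A : KB G hG} {x : G} : x ∈ (A⁻¹).1 ↔ inv x ∈ A.1 := mem_setInv

theorem dom_mem_inv_mul (A : KB G hG) {x : G} (hx : x ∈ A.1) : dom x ∈ (A⁻¹ * A).1 :=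
  ⟨_, ⟨x, hx, rfl⟩, x, hx, isMul_inv_self x⟩

theorem inv_mul_subset (A : KB G hG) : (A⁻¹ * A).1 ⊆ identities G := A.isBisection.1

theorem mul_inv_subset (A : KB G hG) : (A * A⁻¹).1 ⊆ identities G := A.isBisection.2

theorem idem_subset {A : KB G hG} (h : A * A = A) : A.1 ⊆ identities G :=
  A.isBisection.subset_identities (congrArg Subtype.val h)

theorem eq_of_isMul_mul_inv (A : KB G hG) {x y z c w : G} (hx : x ∈ A.1) (hy : inv y ∈ A.1)
    (h₁ : IsMul x y c) (h₂ : IsMul c z w) : w = z :=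
  h₂.eq_of_left (A.mul_inv_subset ⟨x, hx, y, mem_inv.2 hy, h₁⟩)

theorem subset_mul_inv_mul (A : KB G hG) : A.1 ⊆ (A * A⁻¹ * A).1 := fun x hx =>
  ⟨ran x, ⟨x, hx, inv x, ⟨x, hx, rfl⟩, isMul_self_inv x⟩, x, hx, isMul_ran x⟩

theorem mul_inv_mul_self (A : KB G hG) : A * A⁻¹ * A = A := by
  refine ext (Set.Subset.antisymm ?_ A.subset_mul_inv_mul)
  rintro w ⟨c, ⟨x, hx, y, hy, h₁⟩, z, hz, h₂⟩
  rwa [A.eq_of_isMul_mul_inv hx (mem_inv.1 hy) h₁ h₂]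

theorem inv_inv_self (A : KB G hG) : A⁻¹⁻¹ = A := ext (setInv_setInv A.1)

/-- If `A = A * B * A` with `A * B` and `B * A` idempotent, then `A` is contained in `B⁻¹`. -/
theorem subset_inv {A B : KB G hG} (h : A * B * A = A) (hAB : A * B * (A * B) = A * B)
    (hBA : B * A * (B * A) = B * A) : A.1 ⊆ (B⁻¹).1 := by
  intro w hw
  rw [← h] at hw
  obtain ⟨c, ⟨x, hx, y, hy, h₁⟩, z, hz, h₂⟩ := hw
  have hwz : w = z := IsMul.eq_of_left h₂ (idem_subset hAB ⟨x, hx, y, hy, h₁⟩)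
  obtain ⟨b, hb, -⟩ := IsMul.assoc h₁ h₂
  -- `y * z` is an identity, so `z` is the inverse of `y`
  have hyz := hb.inv_left.eq_of_right (idem_subset hBA ⟨y, hy, z, hz, hb⟩)
  rw [mem_inv, hwz, hyz, PartialGroupoid.inv_inv]
  exact hy

instance : InverseSemigroup (KB G hG) where
  mul_assoc A B C := ext (setMul_assoc A.1 B.1 C.1)
  mul_inv_mul := mul_inv_mul_self
  inv_mul_inv A := by
    have := mul_inv_mul_self A⁻¹
    rwa [inv_inv_self] at this
  inv_unique A B h₁ h₂ := by
    have assoc : ∀ A B C : KB G hG, A * B * C = A * (B * C) :=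
      fun A B C => ext (setMul_assoc A.1 B.1 C.1)
    have hAB : A * B * (A * B) = A * B := by rw [← assoc, h₁]
    have hBA : B * A * (B * A) = B * A := by rw [← assoc, h₂]
    refine ext (Set.Subset.antisymm (subset_inv h₂ hBA hAB) ?_)
    rintro x hx
    have := subset_inv h₁ hAB hBA (mem_inv.1 hx)
    rwa [mem_inv, PartialGroupoid.inv_inv] at this

/-- The natural partial order on compact-open bisections is inclusion. -/
theorem le_iff {A B : KB G hG} : A ≤ B ↔ A.1 ⊆ B.1 := by
  constructor
  · rintro ⟨E, hE, rfl⟩ x hx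
    exact (setMul_eq_left (idem_subset hE) hx).1
  · intro h
    refine ⟨A⁻¹ * A, by rw [← _root_.mul_assoc, InverseSemigroup.inv_mul_inv], ext ?_⟩
    refine Set.Subset.antisymm (fun x hx => ?_) (fun x hx => ?_)
    · exact ⟨x, h hx, dom x, A.dom_mem_inv_mul hx, isMul_dom x⟩
    · obtain ⟨hxB, y, hy, z, hz, hyz⟩ := setMul_eq_left A.inv_mul_subset hx
      have hd : dom x = dom z := by rw [← dom_dom x, IsMul.dom_eq hyz]
      rwa [B.isBisection.eq_of_dom hxB (h hz) hd]

theorem isBot_iff {A : KB G hG} : IsBot A ↔ A.1 = ∅ := by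
  constructor
  · intro h
    have h₀ : (∅ : Set G) ∈ compactOpenBisections G :=
      ⟨isCompact_empty, isOpen_empty, isBisection_iff.2 ⟨by simp, by simp⟩⟩
    exact Set.subset_empty_iff.1 (le_iff.1 (h ⟨∅, h₀⟩))
  · intro h B
    rw [le_iff, h]
    exact Set.empty_subset _

theorem iUnion_mem {𝒜 : Set (KB G hG)} (hfin : 𝒜.Finite)
    (h : IsBisection (⋃ A ∈ 𝒜, A.1)) : (⋃ A ∈ 𝒜, A.1) ∈ compactOpenBisections G :=
  ⟨hfin.isCompact_biUnion fun A _ => A.isCompact, isOpen_biUnion fun A _ => A.isOpen, h⟩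

theorem isLUB_of_eq {𝒜 : Set (KB G hG)} {s : KB G hG} (h : s.1 = ⋃ A ∈ 𝒜, A.1) :
    IsLUB 𝒜 s := by
  refine ⟨fun A hA => le_iff.2 ?_, fun B hB => le_iff.2 ?_⟩
  · rw [h]
    exact Set.subset_biUnion_of_mem hA
  · rw [h]
    exact Set.iUnion₂_subset fun A hA => le_iff.1 (hB hA)

theorem isLUB_iff {𝒜 : Set (KB G hG)} (hfin : 𝒜.Finite) {s : KB G hG} :
    IsLUB 𝒜 s ↔ s.1 = ⋃ A ∈ 𝒜, A.1 := by
  refine ⟨fun h => ?_, isLUB_of_eq⟩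
  have hsub : (⋃ A ∈ 𝒜, A.1) ⊆ s.1 := Set.iUnion₂_subset fun A hA => le_iff.1 (h.1 hA)
  have hlub : IsLUB 𝒜 (⟨_, iUnion_mem hfin (s.isBisection.mono hsub)⟩ : KB G hG) :=
    isLUB_of_eq rfl
  rw [h.unique hlub]

theorem isBisection_iUnion {𝒜 : Set (KB G hG)} (h : CompatibleSet 𝒜) :
    IsBisection (⋃ A ∈ 𝒜, A.1) := by
  rw [isBisection_iff]
  constructor
  · intro a ha b hb
    obtain ⟨A, hA, haA⟩ := Set.mem_iUnion₂.1 ha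
    obtain ⟨B, hB, hbB⟩ := Set.mem_iUnion₂.1 hb
    exact setInv_mul_subset_iff.1 (idem_subset (h A hA B hB).1) a haA b hbB
  · intro a ha b hb
    obtain ⟨A, hA, haA⟩ := Set.mem_iUnion₂.1 ha
    obtain ⟨B, hB, hbB⟩ := Set.mem_iUnion₂.1 hb
    exact mul_setInv_subset_iff.1 (idem_subset (h A hA B hB).2) a haA b hbB

instance : DistributiveInverseSemigroup (KB G hG) where
  exists_join 𝒜 hfin h := ⟨⟨_, iUnion_mem hfin (isBisection_iUnion h)⟩, isLUB_of_eq rfl⟩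
  mul_join 𝒜 s C hfin _ hs := by
    rw [isLUB_iff hfin] at hs
    refine isLUB_of_eq ?_
    ext z
    simp only [mem_mul, hs, Set.mem_iUnion, Set.mem_image]
    constructor
    · rintro ⟨x, hx, y, ⟨A, hA, hy⟩, h⟩
      exact ⟨_, ⟨A, hA, rfl⟩, x, hx, y, hy, h⟩
    · rintro ⟨_, ⟨A, hA, rfl⟩, x, hx, y, hy, h⟩
      exact ⟨x, hx, y, ⟨A, hA, hy⟩, h⟩
  join_mul 𝒜 s C hfin _ hs := by
    rw [isLUB_iff hfin] at hs
    refine isLUB_of_eq ?_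
    ext z
    simp only [mem_mul, hs, Set.mem_iUnion, Set.mem_image]
    constructor
    · rintro ⟨x, ⟨A, hA, hx⟩, y, hy, h⟩
      exact ⟨_, ⟨A, hA, rfl⟩, x, hx, y, hy, h⟩
    · rintro ⟨_, ⟨A, hA, rfl⟩, x, hx, y, hy, h⟩
      exact ⟨x, ⟨A, hA, hx⟩, y, hy, h⟩

/-- Every neighbourhood of a point contains a compact-open bisection around the point. -/
theorem exists_mem_subset (hG : IsCoherentEtale G) {g : G} {U : Set G} (hg : g ∈ U)
    (hU : IsOpen U) : ∃ A : KB G hG, g ∈ A.1 ∧ A.1 ⊆ U := by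
  obtain ⟨A, hA, hgA, hAU⟩ := hG.isBasis.exists_subset_of_mem_open hg hU
  exact ⟨⟨A, hA⟩, hgA, hAU⟩

/-- A compact subset of an open set `U` is covered by finitely many compact-open bisections
contained in `U`. -/
theorem exists_finite_cover (hG : IsCoherentEtale G) {K U : Set G} (hK : IsCompact K)
    (hU : IsOpen U) (h : K ⊆ U) :
    ∃ 𝒜 : Set (KB G hG), 𝒜.Finite ∧ (∀ A ∈ 𝒜, A.1 ⊆ U) ∧ K ⊆ ⋃ A ∈ 𝒜, A.1 := by
  obtain ⟨t, ht, hfin, hcov⟩ := hK.elim_finite_subcover_image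
    (b := {A : KB G hG | A.1 ⊆ U}) (c := fun A => A.1) (fun A _ => A.isOpen) (fun g hg => by
      obtain ⟨A, hgA, hAU⟩ := exists_mem_subset hG (h hg) hU
      exact Set.mem_iUnion₂.2 ⟨A, hAU, hgA⟩)
  exact ⟨t, hfin, fun A hA => ht hA, hcov⟩

/-- A compact-open bisection can be interpolated between a compact set and an open bisection. -/
theorem exists_between (hG : IsCoherentEtale G) {K U : Set G} (hK : IsCompact K)
    (hU : IsOpen U) (hU' : IsBisection U) (h : K ⊆ U) : ∃ A : KB G hG, K ⊆ A.1 ∧ A.1 ⊆ U := by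
  obtain ⟨𝒜, hfin, hsub, hcov⟩ := exists_finite_cover hG hK hU h
  have hsub' : (⋃ A ∈ 𝒜, A.1) ⊆ U := Set.iUnion₂_subset hsub
  exact ⟨⟨_, iUnion_mem hfin (hU'.mono hsub')⟩, hcov, hsub'⟩

end KB

end CompactOpenBisections

/-! ### Prime filters of compact-open bisections are points -/

section Points

open PartialGroupoid

variable {G : Type u} [TopologicalSpace G] [PartialGroupoid G]

theorem OpenBisection.isLUB_of_eq {𝒜 : Set (OpenBisection G)} {U : OpenBisection G}
    (h : U.1 = ⋃ A ∈ 𝒜, A.1) : IsLUB 𝒜 U := by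
  refine ⟨fun A hA => ?_, fun B hB => ?_⟩
  · change A.1 ⊆ U.1
    rw [h]
    exact Set.subset_biUnion_of_mem hA
  · change U.1 ⊆ B.1
    rw [h]
    exact Set.iUnion₂_subset fun A hA => hB hA

/-- The join of a family of open bisections, when it exists, is its union. -/
theorem OpenBisection.isLUB_iff {𝒜 : Set (OpenBisection G)} {U : OpenBisection G} :
    IsLUB 𝒜 U ↔ U.1 = ⋃ A ∈ 𝒜, A.1 := by
  refine ⟨fun h => ?_, isLUB_of_eq⟩
  have hsub : (⋃ A ∈ 𝒜, A.1) ⊆ U.1 := Set.iUnion₂_subset fun A hA => h.1 hA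
  have hlub : IsLUB 𝒜 (⟨_, isOpen_biUnion fun A _ => A.2.1, U.2.2.mono hsub⟩ : OpenBisection G) :=
    isLUB_of_eq rfl
  rw [h.unique hlub]

variable {hG : IsCoherentEtale G}

/-- The compact-open bisections containing a given point form a prime filter. -/
theorem KB.isPrimeFilter_point (hG : IsCoherentEtale G) (g : G) :
    IsPrimeFilter {A : KB G hG | g ∈ A.1} := by
  refine ⟨⟨Order.IsPFilter.of_def ?_ ?_ ?_, ?_⟩, ?_⟩
  · obtain ⟨A, hA, -⟩ := KB.exists_mem_subset hG (Set.mem_univ g) isOpen_univ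
    exact ⟨A, hA⟩
  · intro A hA B hB
    obtain ⟨C, hC, hCsub⟩ := KB.exists_mem_subset hG (⟨hA, hB⟩ : g ∈ A.1 ∩ B.1)
      (A.isOpen.inter B.isOpen)
    exact ⟨C, hC, KB.le_iff.2 fun x hx => (hCsub hx).1, KB.le_iff.2 fun x hx => (hCsub hx).2⟩
  · exact fun {A B} hAB hA => KB.le_iff.1 hAB hA
  · intro Z hZ hg
    rw [KB.isBot_iff] at hZ
    exact Set.notMem_empty g (hZ ▸ hg)
  · intro A B C hC hg
    rw [KB.isLUB_iff (Set.toFinite _), Set.biUnion_pair] at hC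
    change g ∈ C.1 at hg
    rwa [hC] at hg

/-- Sobriety: every prime filter of compact-open bisections consists of the compact-open
bisections around some point. The open bisections that contain a member of the filter form a
completely prime filter, by compactness of the members. -/
theorem KB.exists_point {F : Set (KB G hG)} (hF : IsPrimeFilter F) :
    ∃ g : G, ∀ A : KB G hG, A ∈ F ↔ g ∈ A.1 := by
  let toOpen : KB G hG → OpenBisection G := fun A => ⟨A.1, A.isOpen, A.isBisection⟩
  let 𝓕 : Set (OpenBisection G) := {U | ∃ A ∈ F, A.1 ⊆ U.1}
  have h𝓕 : IsCompletelyPrimeFilter 𝓕 := by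
    refine ⟨⟨Order.IsPFilter.of_def ?_ ?_ ?_, ?_⟩, ?_⟩
    · obtain ⟨A, hA⟩ := hF.1.1.toPFilter.nonempty
      exact ⟨toOpen A, A, hA, Set.Subset.rfl⟩
    · rintro U ⟨A, hA, hAU⟩ V ⟨B, hB, hBV⟩
      obtain ⟨C, hC, hCA, hCB⟩ := hF.1.1.toPFilter.directed A hA B hB
      exact ⟨toOpen C, ⟨C, hC, Set.Subset.rfl⟩, (KB.le_iff.1 hCA).trans hAU,
        (KB.le_iff.1 hCB).trans hBV⟩
    · rintro U V hUV ⟨A, hA, hAU⟩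
      exact ⟨A, hA, hAU.trans hUV⟩
    · rintro Z hZ ⟨A, hA, hAZ⟩
      refine hF.1.2 A (KB.isBot_iff.2 (Set.subset_empty_iff.1 (hAZ.trans ?_))) hA
      exact hZ ⟨∅, isOpen_empty, isBisection_iff.2 ⟨by simp, by simp⟩⟩
    · rintro 𝒰 V hV ⟨A, hA, hAV⟩
      rw [OpenBisection.isLUB_iff] at hV
      obtain ⟨t, ht, hfin, hcov⟩ := A.isCompact.elim_finite_subcover_image
        (b := {B : KB G hG | B ≤ A ∧ ∃ U ∈ 𝒰, B.1 ⊆ U.1}) (c := fun B => B.1)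
        (fun B _ => B.isOpen) (fun x hx => by
          obtain ⟨U, hU, hxU⟩ := Set.mem_iUnion₂.1 (hV ▸ hAV hx)
          obtain ⟨B, hxB, hB⟩ := KB.exists_mem_subset hG (⟨hx, hxU⟩ : x ∈ A.1 ∩ U.1)
            (A.isOpen.inter U.2.1)
          exact Set.mem_iUnion₂.2 ⟨B, ⟨KB.le_iff.2 fun y hy => (hB hy).1, U, hU,
            fun y hy => (hB hy).2⟩, hxB⟩)
      obtain ⟨B, hBt, hBF⟩ := hF.exists_mem_of_isLUB hfin (KB.isLUB_of_eq
        (hcov.antisymm (Set.iUnion₂_subset fun B hB => KB.le_iff.1 (ht hB).1))) hA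
      obtain ⟨-, U, hU, hBU⟩ := ht hBt
      exact ⟨U, hU, B, hBF, hBU⟩
  obtain ⟨η, hη⟩ := hG.sober
  obtain ⟨g, hg⟩ := η.surjective ⟨𝓕, h𝓕⟩
  have hpt : 𝓕 = {U : OpenBisection G | g ∈ U.1} := by rw [← hη g, hg]
  refine ⟨g, fun A => ⟨fun hA => ?_, fun hA => ?_⟩⟩
  · have : toOpen A ∈ 𝓕 := ⟨A, hA, Set.Subset.rfl⟩
    rwa [hpt] at this
  · have : toOpen A ∈ 𝓕 := hpt ▸ hA
    obtain ⟨B, hB, hBA⟩ := this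
    exact hF.1.1.toPFilter.mem_of_le (KB.le_iff.2 hBA) hB

/-- Points of a coherent étale groupoid are separated by the compact-open bisections. -/
theorem KB.point_ext (hG : IsCoherentEtale G) {g h : G}
    (H : ∀ A : KB G hG, g ∈ A.1 ↔ h ∈ A.1) : g = h := by
  have key : ∀ U : OpenBisection G, ∀ {x y : G}, (∀ A : KB G hG, x ∈ A.1 → y ∈ A.1) →
      x ∈ U.1 → y ∈ U.1 := by
    intro U x y hxy hx
    obtain ⟨A, hA, hAU⟩ := KB.exists_mem_subset hG hx U.2.1
    exact hAU (hxy A hA)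
  obtain ⟨η, hη⟩ := hG.sober
  refine η.injective (Subtype.ext ?_)
  rw [hη, hη]
  ext U
  exact ⟨key U fun A => (H A).1, key U fun A => (H A).2⟩

end Points

/-! ### The functor of compact-open bisections -/

section Functor

open PartialGroupoid

variable {G : Type u} {H : Type v} [TopologicalSpace G] [PartialGroupoid G]
  [TopologicalSpace H] [PartialGroupoid H] {hG : IsCoherentEtale G} {hH : IsCoherentEtale H}

theorem CoherentCovering.map_isMul (α : CoherentCovering G H) {x y z : G} (h : IsMul x y z) :
    IsMul (α.toFun x) (α.toFun y) (α.toFun z) := by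
  obtain ⟨h, rfl⟩ := h
  exact ⟨_, (α.map_mul x y h).symm⟩

theorem CoherentCovering.map_ran (α : CoherentCovering G H) (x : G) :
    α.toFun (ran x) = ran (α.toFun x) := by
  rw [← ran_of_identity (α.map_identity (ran_mem x))]
  exact (α.map_isMul (isMul_ran x)).ran_eq.symm

theorem CoherentCovering.map_inv (α : CoherentCovering G H) (x : G) :
    α.toFun (inv x) = inv (α.toFun x) := by
  have h := (α.map_isMul (isMul_self_inv x)).inv_left
  rw [α.map_ran] at h
  exact h.unique (isMul_self_inv _).inv_left

/-- Inverse images of bisections under covering functors are bisections. -/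
theorem CoherentCovering.isBisection_preimage (α : CoherentCovering G H) {A : Set H}
    (hA : IsBisection A) : IsBisection (α.toFun ⁻¹' A) := by
  have key : ∀ {B : Set H}, IsBisection B → ∀ a ∈ α.toFun ⁻¹' B, ∀ b ∈ α.toFun ⁻¹' B,
      dom a = dom b → a = b := fun hB a ha b hb h =>
    α.cover_inj a b h (hB.eq_of_dom ha hb (by rw [← α.map_dom, h, α.map_dom]))
  refine isBisection_iff.2 ⟨fun a ha b hb h => ?_, key hA⟩
  have h' := key hA.setInv (inv a) (mem_setInv.2 (by
    rw [α.map_inv, PartialGroupoid.inv_inv]; exact ha)) (inv b) (mem_setInv.2 (by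
    rw [α.map_inv, PartialGroupoid.inv_inv]; exact hb)) (by rw [dom_inv, dom_inv, h])
  rw [← PartialGroupoid.inv_inv a, h', PartialGroupoid.inv_inv]

/-- The inverse image of a compact-open bisection. -/
def KB.comap (hG : IsCoherentEtale G) (α : CoherentCovering G H) (A : KB H hH) : KB G hG :=
  ⟨α.toFun ⁻¹' A.1, (α.coherent _ A.isCompact A.isOpen).1, (α.coherent _ A.isCompact A.isOpen).2,
    α.isBisection_preimage A.isBisection⟩

/-- Inverse image along a coherent continuous covering functor is a callitic morphism. Unique
lifting makes it multiplicative, and compactness gives (DC1). -/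
def KB.comapHom (hG : IsCoherentEtale G) (hH : IsCoherentEtale H) (α : CoherentCovering G H) :
    CalliticHom (KB H hH) (KB G hG) where
  toFun := KB.comap hG α
  map_mul A B := by
    ext z
    constructor
    · rintro ⟨a, ha, b, hb, h⟩
      have h : IsMul a b (α.toFun z) := h
      obtain ⟨y, hy, rfl⟩ := α.cover_surj (dom z) (dom_mem z) b (by rw [α.map_dom, h.dom_eq])
      obtain ⟨x, hx⟩ := exists_isMul (x := z) (y := inv y) (by rw [ran_inv, hy])
      have hxy := hx.inv_right
      rw [PartialGroupoid.inv_inv] at hxy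
      refine ⟨x, ?_, y, hb, hxy⟩
      have hax := h.inv_right
      rw [← α.map_inv] at hax
      change α.toFun x ∈ A.1
      rwa [(α.map_isMul hx).unique hax]
    · rintro ⟨x, hx, y, hy, h⟩
      exact ⟨_, hx, _, hy, α.map_isMul h⟩
  map_join 𝒜 s hfin _ hs := by
    rw [KB.isLUB_iff hfin] at hs
    refine KB.isLUB_of_eq ?_
    rw [Set.biUnion_image]
    change α.toFun ⁻¹' s.1 = _
    rw [hs, Set.preimage_iUnion₂]
    rfl
  dc1 A B T hA hB := by
    obtain ⟨C, hC, hCsub⟩ := KB.exists_between hH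
      (K := α.toFun '' T.1) (U := A.1 ∩ B.1) (T.isCompact.image α.continuous_toFun)
      (A.isOpen.inter B.isOpen) (A.isBisection.mono Set.inter_subset_left)
      (Set.image_subset_iff.2 fun x hx => ⟨KB.le_iff.1 hA hx, KB.le_iff.1 hB hx⟩)
    exact ⟨C, KB.le_iff.2 fun x hx => (hCsub hx).1, KB.le_iff.2 fun x hx => (hCsub hx).2,
      KB.le_iff.2 (Set.image_subset_iff.1 hC)⟩
  dc2 F hF := by
    obtain ⟨g, hg⟩ := KB.exists_point hF
    obtain ⟨A, hA, -⟩ := KB.exists_mem_subset hH (Set.mem_univ (α.toFun g)) isOpen_univ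
    exact ⟨A, (hg _).2 hA⟩

/-- The functor sending a coherent étale groupoid to its distributive inverse semigroup of
compact-open bisections. -/
def bisectionFunctor : CohEtaleGpd.{u} ⥤ DistInvSgp.{u}ᵒᵖ where
  obj G := Opposite.op ⟨KB G.carrier G.isCoherentEtale⟩
  map {G H} α := Quiver.Hom.op
    (X := (⟨KB H.carrier H.isCoherentEtale⟩ : DistInvSgp))
    (Y := (⟨KB G.carrier G.isCoherentEtale⟩ : DistInvSgp))
    (KB.comapHom G.isCoherentEtale H.isCoherentEtale α)
  map_id _ := rfl
  map_comp _ _ := rfl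

/-- A coherent covering functor is determined by the inverse images of the compact-open
bisections. -/
theorem KB.comapHom_injective (hG : IsCoherentEtale G) (hH : IsCoherentEtale H) :
    Function.Injective (KB.comapHom hG hH) := by
  intro α β h
  ext g
  refine KB.point_ext hH fun A => ?_
  change g ∈ ((KB.comapHom hG hH α).toFun A).1 ↔ g ∈ ((KB.comapHom hG hH β).toFun A).1
  rw [h]

instance : bisectionFunctor.{u}.Faithful where
  map_injective {G H} _ _ h :=
    KB.comapHom_injective G.isCoherentEtale H.isCoherentEtale (congrArg Quiver.Hom.unop h)

end Functor

/-! ### Recovering a covering functor from a callitic morphism -/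

section Full

open PartialGroupoid

variable {G : Type u} {H : Type v} [TopologicalSpace G] [PartialGroupoid G]
  [TopologicalSpace H] [PartialGroupoid H] {hG : IsCoherentEtale G} {hH : IsCoherentEtale H}

namespace KB

theorem mem_mul_iff_dom_mem {A E : KB G hG} (hE : E * E = E) {x : G} (hx : x ∈ A.1) :
    x ∈ (A * E).1 ↔ dom x ∈ E.1 :=
  ⟨fun h => (setMul_eq_left (idem_subset hE) h).2, fun h => ⟨x, hx, dom x, h, isMul_dom x⟩⟩

theorem mem_inv_mul_iff {A C : KB G hG} {x y z : G} (hx : x ∈ A.1) (h : IsMul x y z) :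
    y ∈ (A⁻¹ * C).1 ↔ z ∈ C.1 := by
  constructor
  · rintro ⟨a, ha, c, hc, hac⟩
    have hac : IsMul a c y := hac
    have hxa : x = inv a := A.isBisection.eq_of_dom hx (mem_inv.1 ha) (by
      rw [h.dom_eq_ran, dom_inv, hac.ran_eq])
    rwa [h.unique (hxa ▸ hac.inv_left)]
  · exact fun hz => ⟨inv x, ⟨x, hx, rfl⟩, z, hz, h.inv_left⟩

theorem mul_self_of_subset {E : KB G hG} (hE : E.1 ⊆ identities G) : E * E = E := by
  refine ext (Set.Subset.antisymm (fun x hx => (setMul_eq_left hE hx).1) fun x hx => ?_)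
  exact ⟨x, hx, x, hx, mem_identities_iff.1 (hE hx)⟩

/-- Two points are equal if they lie in the same idempotent compact-open bisections and one of
them is an identity. -/
theorem point_ext_of_idem (hG : IsCoherentEtale G) {p q : G}
    (h : ∀ E : KB G hG, E * E = E → (p ∈ E.1 ↔ q ∈ E.1)) {x : G} (hq : q = dom x) : p = q := by
  obtain ⟨B, hxB, -⟩ := exists_mem_subset hG (Set.mem_univ x) isOpen_univ
  have hB : (B⁻¹ * B) * (B⁻¹ * B) = B⁻¹ * B := mul_self_of_subset B.inv_mul_subset
  have hqB : q ∈ (B⁻¹ * B).1 := hq ▸ B.dom_mem_inv_mul hxB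
  have key : ∀ {a : G} (C : KB G hG), a ∈ C.1 → a ∈ (B⁻¹ * B).1 →
      ∃ E : KB G hG, E * E = E ∧ a ∈ E.1 ∧ E.1 ⊆ C.1 := by
    intro a C haC haB
    obtain ⟨E, haE, hE⟩ := exists_mem_subset hG (⟨haC, haB⟩ : a ∈ C.1 ∩ (B⁻¹ * B).1)
      (C.isOpen.inter (B⁻¹ * B).isOpen)
    exact ⟨E, mul_self_of_subset fun y hy => B.inv_mul_subset (hE hy).2, haE,
      fun y hy => (hE hy).1⟩
  refine point_ext hG fun C => ⟨fun hC => ?_, fun hC => ?_⟩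
  · obtain ⟨E, hE, hpE, hEC⟩ := key C hC ((h _ hB).2 hqB)
    exact hEC ((h E hE).1 hpE)
  · obtain ⟨E, hE, hqE, hEC⟩ := key C hC hqB
    exact hEC ((h E hE).2 hqE)

theorem exists_pointMap (θ : CalliticHom (KB H hH) (KB G hG)) (g : G) :
    ∃ h : H, ∀ A : KB H hH, g ∈ (θ.toFun A).1 ↔ h ∈ A.1 :=
  exists_point (θ.preimage_isPrimeFilter (isPrimeFilter_point hG g))

/-- The map on points dual to a callitic morphism `θ`: it sends `g` to the point whose prime
filter is the inverse image under `θ` of the prime filter of `g`. -/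
noncomputable def pointMap (θ : CalliticHom (KB H hH) (KB G hG)) (g : G) : H :=
  (exists_pointMap θ g).choose

variable (θ : CalliticHom (KB H hH) (KB G hG))

theorem pointMap_mem {g : G} {A : KB H hH} : pointMap θ g ∈ A.1 ↔ g ∈ (θ.toFun A).1 :=
  ((exists_pointMap θ g).choose_spec A).symm

theorem exists_pointMap_mem (g : G) : ∃ A : KB H hH, pointMap θ g ∈ A.1 := by
  obtain ⟨A, hA, -⟩ := exists_mem_subset hH (Set.mem_univ (pointMap θ g)) isOpen_univ
  exact ⟨A, hA⟩

theorem pointMap_inv (x : G) : pointMap θ (inv x) = inv (pointMap θ x) := by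
  refine point_ext hH fun A => ?_
  rw [pointMap_mem, ← mem_inv, ← mem_inv, pointMap_mem, θ.map_inv]

theorem pointMap_dom (x : G) : pointMap θ (dom x) = dom (pointMap θ x) := by
  refine point_ext_of_idem hH (fun E hE => ?_) rfl
  obtain ⟨B, hB⟩ := exists_pointMap_mem θ x
  rw [pointMap_mem, ← mem_mul_iff_dom_mem hE hB, pointMap_mem, θ.map_mul,
    mem_mul_iff_dom_mem (by rw [← θ.map_mul, hE]) ((pointMap_mem θ).1 hB)]

theorem pointMap_isMul {x y z : G} (h : IsMul x y z) :
    IsMul (pointMap θ x) (pointMap θ y) (pointMap θ z) := by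
  obtain ⟨w, hw⟩ := exists_isMul (x := pointMap θ x) (y := pointMap θ y) (by
    rw [← pointMap_dom, h.dom_eq_ran, ← dom_inv, pointMap_dom, pointMap_inv, dom_inv])
  suffices w = pointMap θ z from this ▸ hw
  obtain ⟨A, hA⟩ := exists_pointMap_mem θ x
  refine point_ext hH fun C => ?_
  rw [← mem_inv_mul_iff hA hw, pointMap_mem, pointMap_mem, θ.map_mul, θ.map_inv,
    mem_inv_mul_iff ((pointMap_mem θ).1 hA) h]

/-- The coherent continuous covering functor dual to a callitic morphism. -/
noncomputable def pointCovering : CoherentCovering G H where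
  toFun := pointMap θ
  map_comp x y h := (pointMap_isMul θ ⟨h, rfl⟩).1
  map_mul x y h := (pointMap_isMul θ ⟨h, rfl⟩).2.symm
  continuous_toFun := hH.isBasis.continuous_iff.2 fun A hA => by
    have : pointMap θ ⁻¹' A = (θ.toFun ⟨A, hA⟩).1 := Set.ext fun g => pointMap_mem θ (A := ⟨A, hA⟩)
    rw [this]
    exact isOpen _
  cover_inj g g' hd h := by
    obtain ⟨A, hA⟩ := exists_pointMap_mem θ g
    exact (θ.toFun A).isBisection.eq_of_dom ((pointMap_mem θ).1 hA)
      ((pointMap_mem θ).1 (h ▸ hA)) hd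
  cover_surj e he h hh := by
    obtain ⟨B, hB, -⟩ := exists_mem_subset hH (Set.mem_univ h) isOpen_univ
    have heB := (pointMap_mem θ).1 (hh ▸ B.dom_mem_inv_mul hB)
    rw [θ.map_mul, θ.map_inv] at heB
    obtain ⟨b, hb, c, hc, hbc⟩ := heB
    have hbc : IsMul b c e := hbc
    have hdom : dom c = e := by rw [← hbc.dom_eq, dom_of_identity he]
    refine ⟨c, hdom, B.isBisection.eq_of_dom ((pointMap_mem θ).2 hc) hB ?_⟩
    rw [← pointMap_dom, hdom, hh]
  coherent X hX hX' := by
    obtain ⟨𝒜, hfin, hsub, hcov⟩ := exists_finite_cover hH hX hX' Set.Subset.rfl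
    have : pointMap θ ⁻¹' X = ⋃ A ∈ 𝒜, (θ.toFun A).1 := by
      ext g
      rw [hcov.antisymm (Set.iUnion₂_subset hsub)]
      simp only [Set.mem_preimage, Set.mem_iUnion, pointMap_mem]
    rw [this]
    exact ⟨hfin.isCompact_biUnion fun A _ => isCompact _, isOpen_biUnion fun A _ => isOpen _⟩

theorem comapHom_pointCovering : comapHom hG hH (pointCovering θ) = θ := by
  ext A x
  exact pointMap_mem θ

end KB

instance : bisectionFunctor.{u}.Full where
  map_surjective θ := ⟨KB.pointCovering θ.unop,
    Quiver.Hom.unop_inj (KB.comapHom_pointCovering θ.unop)⟩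

end Full

/-! ### The groupoid of prime filters -/

section Spectrum

open InverseSemigroup

/-- The set of prime filters of a distributive inverse semigroup, the arrows of its dual
groupoid. -/
def Spec (S : Type u) [DistributiveInverseSemigroup S] : Type u := {F : Set S // IsPrimeFilter F}

namespace Spec

variable {S : Type u} [DistributiveInverseSemigroup S]

@[ext]
theorem ext {F K : Spec S} (h : ∀ s, s ∈ F.1 ↔ s ∈ K.1) : F = K := Subtype.ext (Set.ext h)

/-- The upward closure of the elements `a⁻¹ * a` with `a ∈ F`. -/
def domSet (F : Set S) : Set S := {s | ∃ a ∈ F, a⁻¹ * a ≤ s}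

/-- The upward closure of the elements `a * a⁻¹` with `a ∈ F`. -/
def ranSet (F : Set S) : Set S := {s | ∃ a ∈ F, a * a⁻¹ ≤ s}

/-- The upward closure of the set of products of elements of `F` and `K`. -/
def prodSet (F K : Set S) : Set S := {s | ∃ a ∈ F, ∃ b ∈ K, a * b ≤ s}

/-- The set of elements whose inverse is in `F`. -/
def invSet (F : Set S) : Set S := {s | s⁻¹ ∈ F}

theorem inv_mem_invSet {F : Set S} {a : S} (ha : a ∈ F) : a⁻¹ ∈ invSet F := by
  change a⁻¹⁻¹ ∈ F
  rwa [inv_inv_self]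

theorem domSet_invSet (F : Set S) : domSet (invSet F) = ranSet F := by
  ext s
  constructor
  · rintro ⟨a, ha, h⟩
    exact ⟨a⁻¹, ha, by rwa [inv_inv_self]⟩
  · rintro ⟨a, ha, h⟩
    exact ⟨a⁻¹, inv_mem_invSet ha, by rwa [inv_inv_self]⟩

theorem ranSet_invSet (F : Set S) : ranSet (invSet F) = domSet F := by
  ext s
  constructor
  · rintro ⟨a, ha, h⟩
    exact ⟨a⁻¹, ha, by rwa [inv_inv_self]⟩
  · rintro ⟨a, ha, h⟩
    exact ⟨a⁻¹, inv_mem_invSet ha, by rwa [inv_inv_self]⟩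

theorem prodSet_assoc (F K L : Set S) :
    prodSet (prodSet F K) L = prodSet F (prodSet K L) := by
  ext s
  constructor
  · rintro ⟨x, ⟨a, ha, b, hb, hx⟩, c, hc, h⟩
    exact ⟨a, ha, b * c, ⟨b, hb, c, hc, le_rfl⟩,
      (mul_assoc a b c).symm.le.trans ((mul_le_mul hx le_rfl).trans h)⟩
  · rintro ⟨a, ha, x, ⟨b, hb, c, hc, hx⟩, h⟩
    exact ⟨a * b, ⟨a, ha, b, hb, le_rfl⟩, c, hc,
      (mul_assoc a b c).le.trans ((mul_le_mul le_rfl hx).trans h)⟩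

section PrimeFilter

variable {F K : Set S}

theorem mul_mem_of_mem_ranSet (hK : IsPrimeFilter K) {x b : S} (hx : x ∈ ranSet K)
    (hb : b ∈ K) : x * b ∈ K := by
  obtain ⟨a, ha, hax⟩ := hx
  obtain ⟨k, hk, hka, hkb⟩ := hK.exists_le_le ha hb
  refine hK.mem_of_le ?_ hk
  calc k = k * k⁻¹ * k := (mul_inv_mul k).symm
    _ ≤ a * a⁻¹ * b := mul_le_mul (mul_le_mul hka (inv_le_inv hka)) hkb
    _ ≤ x * b := mul_le_mul hax le_rfl

theorem mul_mem_of_mem_domSet (hF : IsPrimeFilter F) {x a : S} (hx : x ∈ domSet F)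
    (ha : a ∈ F) : a * x ∈ F := by
  obtain ⟨b, hb, hbx⟩ := hx
  obtain ⟨k, hk, hka, hkb⟩ := hF.exists_le_le ha hb
  refine hF.mem_of_le ?_ hk
  calc k = k * (k⁻¹ * k) := by rw [← mul_assoc, mul_inv_mul]
    _ ≤ a * (b⁻¹ * b) := mul_le_mul hka (mul_le_mul (inv_le_inv hkb) hkb)
    _ ≤ a * x := mul_le_mul le_rfl hbx

theorem inv_mul_mem_domSet (hF : IsPrimeFilter F) {a b : S} (ha : a ∈ F) (hb : b ∈ F) :
    a⁻¹ * b ∈ domSet F := by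
  obtain ⟨k, hk, hka, hkb⟩ := hF.exists_le_le ha hb
  exact ⟨k, hk, mul_le_mul (inv_le_inv hka) hkb⟩

theorem mul_inv_mem_ranSet (hF : IsPrimeFilter F) {a b : S} (ha : a ∈ F) (hb : b ∈ F) :
    a * b⁻¹ ∈ ranSet F := by
  obtain ⟨k, hk, hka, hkb⟩ := hF.exists_le_le ha hb
  exact ⟨k, hk, mul_le_mul hka (inv_le_inv hkb)⟩

theorem isPrimeFilter_invSet (hF : IsPrimeFilter F) : IsPrimeFilter (invSet F) := by
  refine .mk' ?_ ?_ ?_ ?_ ?_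
  · obtain ⟨a, ha⟩ := hF.nonempty
    exact ⟨a⁻¹, inv_mem_invSet ha⟩
  · intro a ha b hb
    obtain ⟨c, hc, hca, hcb⟩ := hF.exists_le_le ha hb
    refine ⟨c⁻¹, inv_mem_invSet hc, ?_, ?_⟩
    · exact inv_le_comm.2 hca
    · exact inv_le_comm.2 hcb
  · exact fun a b hab ha => hF.mem_of_le (inv_le_inv hab) ha
  · exact fun z hz => hF.1.2 _ (isBot_inv hz)
  · exact fun a b c hc => hF.2 _ _ _ (isLUB_inv hc)

/-- The translate of a prime filter by an element `x` whose domain belongs to the range of the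
filter. Since left multiplication by `x⁻¹` preserves joins, primeness is inherited. -/
theorem isPrimeFilter_translate (hK : IsPrimeFilter K) {x : S} (hx : x⁻¹ * x ∈ ranSet K) :
    IsPrimeFilter {u | x⁻¹ * u ∈ K} := by
  have hxK : ∀ p ∈ K, x⁻¹ * (x * p) ∈ K := fun p hp => by
    rw [← mul_assoc]
    exact mul_mem_of_mem_ranSet hK hx hp
  refine .mk' ?_ ?_ ?_ ?_ ?_
  · obtain ⟨p, hp⟩ := hK.nonempty
    exact ⟨x * p, hxK p hp⟩
  · intro a ha b hb
    obtain ⟨c, hc, hca, hcb⟩ := hK.exists_le_le ha hb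
    exact ⟨x * c, hxK c hc, (mul_le_mul le_rfl hca).trans (mul_inv_mul_le x a),
      (mul_le_mul le_rfl hcb).trans (mul_inv_mul_le x b)⟩
  · exact fun a b hab ha => hK.mem_of_le (mul_le_mul le_rfl hab) ha
  · exact fun z hz => hK.1.2 _ (isBot_mul_left hz _)
  · exact fun a b c hc => hK.2 _ _ _ (isLUB_mul_left hc _)

theorem prodSet_eq_translate (hF : IsPrimeFilter F) (hK : IsPrimeFilter K)
    (h : domSet F = ranSet K) {a : S} (ha : a ∈ F) : prodSet F K = {u | a⁻¹ * u ∈ K} := by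
  ext s
  constructor
  · rintro ⟨a', ha', b, hb, hs⟩
    have hmem := mul_mem_of_mem_ranSet hK (h ▸ inv_mul_mem_domSet hF ha ha') hb
    refine hK.mem_of_le ?_ hmem
    rw [mul_assoc]
    exact mul_le_mul le_rfl hs
  · exact fun hs => ⟨a, ha, _, hs, mul_inv_mul_le a s⟩

theorem isPrimeFilter_prodSet (hF : IsPrimeFilter F) (hK : IsPrimeFilter K)
    (h : domSet F = ranSet K) : IsPrimeFilter (prodSet F K) := by
  obtain ⟨a, ha⟩ := hF.nonempty
  rw [prodSet_eq_translate hF hK h ha]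
  exact isPrimeFilter_translate hK (h ▸ inv_mul_mem_domSet hF ha ha)

theorem domSet_prodSet (hF : IsPrimeFilter F) (hK : IsPrimeFilter K)
    (h : domSet F = ranSet K) : domSet (prodSet F K) = domSet K := by
  have key : ∀ a b : S, (a * b)⁻¹ * (a * b) = b⁻¹ * (a⁻¹ * a * b) := fun a b => by
    rw [inv_of_mul]; simp only [mul_assoc]
  ext s
  constructor
  · rintro ⟨x, ⟨a, ha, b, hb, hx⟩, hs⟩
    obtain ⟨k, hk, hkle⟩ := inv_mul_mem_domSet hK hb
      (mul_mem_of_mem_ranSet hK (h ▸ inv_mul_mem_domSet hF ha ha) hb)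
    refine ⟨k, hk, hkle.trans ?_⟩
    rw [← key]
    exact (mul_le_mul (inv_le_inv hx) hx).trans hs
  · rintro ⟨b, hb, hs⟩
    obtain ⟨a, ha⟩ := hF.nonempty
    refine ⟨a * b, ⟨a, ha, b, hb, le_rfl⟩, ?_⟩
    rw [key]
    exact (mul_le_mul le_rfl (idem_mul_le b (idem_inv_mul a))).trans hs

theorem ranSet_prodSet (hF : IsPrimeFilter F) (hK : IsPrimeFilter K)
    (h : domSet F = ranSet K) : ranSet (prodSet F K) = ranSet F := by
  have key : ∀ a b : S, a * b * (a * b)⁻¹ = a * (b * b⁻¹) * a⁻¹ := fun a b => by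
    rw [inv_of_mul]; simp only [mul_assoc]
  ext s
  constructor
  · rintro ⟨x, ⟨a, ha, b, hb, hx⟩, hs⟩
    obtain ⟨k, hk, hkle⟩ := mul_inv_mem_ranSet hF
      (mul_mem_of_mem_domSet hF (h ▸ mul_inv_mem_ranSet hK hb hb) ha) ha
    refine ⟨k, hk, hkle.trans ?_⟩
    rw [← key]
    exact (mul_le_mul hx (inv_le_inv hx)).trans hs
  · rintro ⟨a, ha, hs⟩
    obtain ⟨b, hb⟩ := hK.nonempty
    refine ⟨a * b, ⟨a, ha, b, hb, le_rfl⟩, ?_⟩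
    rw [key]
    exact (mul_le_mul (mul_idem_le a (idem_mul_inv b)) le_rfl).trans hs

theorem prodSet_invSet_cancel_left (hF : IsPrimeFilter F) (hK : IsPrimeFilter K)
    (h : domSet F = ranSet K) : prodSet (invSet F) (prodSet F K) = K := by
  ext s
  constructor
  · rintro ⟨x, hx, y, ⟨a, ha, b, hb, hy⟩, hs⟩
    have hmem := mul_mem_of_mem_ranSet hK (h ▸ inv_mul_mem_domSet hF hx ha) hb
    rw [inv_inv_self, mul_assoc] at hmem
    exact hK.mem_of_le ((mul_le_mul le_rfl hy).trans hs) hmem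
  · intro hs
    obtain ⟨a, ha⟩ := hF.nonempty
    refine ⟨a⁻¹, inv_mem_invSet ha, a * s,
      ⟨a, ha, s, hs, le_rfl⟩, ?_⟩
    rw [← mul_assoc]
    exact idem_mul_le s (idem_inv_mul a)

theorem prodSet_invSet_cancel_right (hF : IsPrimeFilter F) (hK : IsPrimeFilter K)
    (h : domSet F = ranSet K) : prodSet (prodSet F K) (invSet K) = F := by
  ext s
  constructor
  · rintro ⟨x, ⟨a, ha, b, hb, hx⟩, y, hy, hs⟩
    have hmem := mul_mem_of_mem_domSet hF (h ▸ mul_inv_mem_ranSet hK hb hy) ha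
    rw [inv_inv_self, ← mul_assoc] at hmem
    exact hF.mem_of_le ((mul_le_mul hx le_rfl).trans hs) hmem
  · intro hs
    obtain ⟨b, hb⟩ := hK.nonempty
    refine ⟨s * b, ⟨s, hs, b, hb, le_rfl⟩, b⁻¹, inv_mem_invSet hb, ?_⟩
    rw [mul_assoc]
    exact mul_idem_le s (idem_mul_inv b)

end PrimeFilter

/-- Prime filters `F` and `K` are composable when the domain of `F` is the range of `K`; their
product is the upward closure of the set of products. -/
instance : PartialGroupoid (Spec S) where
  Comp F K := domSet F.1 = ranSet K.1
  mul F K h := ⟨prodSet F.1 K.1, isPrimeFilter_prodSet F.2 K.2 h⟩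
  inv F := ⟨invSet F.1, isPrimeFilter_invSet F.2⟩
  inv_inv F := by
    ext s
    change s⁻¹⁻¹ ∈ F.1 ↔ _
    rw [inv_inv_self]
  comp_mul_left F K L h k := (domSet_prodSet F.2 K.2 h).trans k
  comp_mul_right F K L h k := h.trans (ranSet_prodSet K.2 L.2 k).symm
  mul_assoc F K L h k := Subtype.ext (prodSet_assoc F.1 K.1 L.1)
  inv_comp F := domSet_invSet F.1
  comp_inv F := (ranSet_invSet F.1).symm
  inv_mul_cancel F K h := Subtype.ext (prodSet_invSet_cancel_left F.2 K.2 h)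
  mul_inv_cancel F K h := Subtype.ext (prodSet_invSet_cancel_right F.2 K.2 h)

theorem isMul_iff {F K L : Spec S} :
    IsMul F K L ↔ domSet F.1 = ranSet K.1 ∧ prodSet F.1 K.1 = L.1 :=
  ⟨fun ⟨h, hL⟩ => ⟨h, congrArg Subtype.val hL⟩, fun ⟨h, hL⟩ => ⟨h, Subtype.ext hL⟩⟩

theorem mul_mem {F K L : Spec S} (h : IsMul F K L) {a b : S} (ha : a ∈ F.1) (hb : b ∈ K.1) :
    a * b ∈ L.1 := (isMul_iff.1 h).2 ▸ ⟨a, ha, b, hb, le_rfl⟩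

theorem inv_mem_inv {F : Spec S} {s : S} (hs : s ∈ F.1) : s⁻¹ ∈ (PartialGroupoid.inv F).1 :=
  inv_mem_invSet hs

theorem mem_dom {F : Spec S} {s : S} : s ∈ (dom F).1 ↔ ∃ a ∈ F.1, a⁻¹ * a ≤ s := by
  constructor
  · rintro ⟨a, ha, b, hb, h⟩
    obtain ⟨k, hk, hkle⟩ := inv_mul_mem_domSet F.2 ha hb
    rw [inv_inv_self] at hkle
    exact ⟨k, hk, hkle.trans h⟩
  · rintro ⟨a, ha, h⟩
    exact ⟨a⁻¹, inv_mem_inv ha, a, ha, h⟩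

/-- The identities of the groupoid are the prime filters that contain an idempotent. -/
theorem mem_identities_iff {F : Spec S} :
    F ∈ identities (Spec S) ↔ ∃ e ∈ F.1, e * e = e := by
  constructor
  · intro hF
    rw [← dom_of_identity hF]
    obtain ⟨a, ha⟩ := F.2.nonempty
    exact ⟨a⁻¹ * a, mem_dom.2 ⟨a, ha, le_rfl⟩, idem_inv_mul a⟩
  · rintro ⟨e, heF, he⟩
    have hdom : dom F = F := by
      ext s
      rw [mem_dom]
      constructor
      · rintro ⟨a, ha, hs⟩
        obtain ⟨k, hk, hka, hke⟩ := F.2.exists_le_le ha heF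
        have hkk := idem_of_le hke he
        refine F.2.mem_of_le ?_ hk
        calc k = k⁻¹ * k := by rw [inv_idem hkk, hkk]
          _ ≤ a⁻¹ * a := mul_le_mul (inv_le_inv hka) hka
          _ ≤ s := hs
      · intro hs
        obtain ⟨k, hk, hks, hke⟩ := F.2.exists_le_le hs heF
        have hkk := idem_of_le hke he
        exact ⟨k, hk, by rwa [inv_idem hkk, hkk]⟩
    rw [← hdom]
    exact dom_mem F

theorem exists_idem_le {E : Spec S} (hE : E ∈ identities (Spec S)) {s : S} (hs : s ∈ E.1) :
    ∃ e ∈ E.1, e ≤ s ∧ e * e = e := by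
  obtain ⟨e, he, hee⟩ := mem_identities_iff.1 hE
  obtain ⟨k, hk, hks, hke⟩ := E.2.exists_le_le hs he
  exact ⟨k, hk, hks, idem_of_le hke hee⟩

/-- An identity prime filter containing `t⁻¹ * t` lifts to a prime filter containing `t`. -/
theorem exists_lift {E : Spec S} (hE : E ∈ identities (Spec S)) {t : S}
    (ht : t⁻¹ * t ∈ E.1) : ∃ F : Spec S, t ∈ F.1 ∧ dom F = E := by
  have hran : t⁻¹ * t ∈ ranSet E.1 := by
    obtain ⟨e, he, hle, hee⟩ := exists_idem_le hE ht
    exact ⟨e, he, by rwa [inv_idem hee, hee]⟩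
  let F : Spec S := ⟨_, isPrimeFilter_translate E.2 hran⟩
  refine ⟨F, ht, ?_⟩
  ext s
  rw [mem_dom]
  constructor
  · rintro ⟨u, hu, hs⟩
    have hmem : (t⁻¹ * u)⁻¹ * (t⁻¹ * u) ∈ (dom E).1 := mem_dom.2 ⟨_, hu, le_rfl⟩
    rw [dom_of_identity hE] at hmem
    refine E.2.mem_of_le ?_ hmem
    calc (t⁻¹ * u)⁻¹ * (t⁻¹ * u) = u⁻¹ * (t * (t⁻¹ * u)) := by
          rw [inv_of_mul, inv_inv_self, mul_assoc]
      _ ≤ u⁻¹ * u := mul_le_mul le_rfl (mul_inv_mul_le t u)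
      _ ≤ s := hs
  · intro hs
    obtain ⟨e, he, hle, hee⟩ := exists_idem_le hE hs
    refine ⟨t * e, ?_, ?_⟩
    · change t⁻¹ * (t * e) ∈ E.1
      rw [← mul_assoc]
      exact mul_mem_of_mem_ranSet E.2 hran he
    · calc (t * e)⁻¹ * (t * e) = e * (t⁻¹ * t) * e := by
            rw [inv_of_mul, inv_idem hee]; simp only [mul_assoc]
        _ ≤ e * e := mul_le_mul (mul_idem_le e (idem_inv_mul t)) le_rfl
        _ = e := hee
        _ ≤ s := hle

end Spec

end Spectrum

/-! ### The topology on the groupoid of prime filters -/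

section SpectrumTopology

open InverseSemigroup TopologicalSpace

namespace Spec

variable {S : Type u} [DistributiveInverseSemigroup S]

/-- The basic set of all prime filters that contain `s`. -/
def basic (s : S) : Set (Spec S) := {F | s ∈ F.1}

instance : TopologicalSpace (Spec S) := generateFrom (Set.range basic)

theorem isTopologicalBasis_basic : IsTopologicalBasis (Set.range (basic (S := S))) where
  exists_subset_inter := by
    rintro _ ⟨s, rfl⟩ _ ⟨t, rfl⟩ F ⟨hs, ht⟩
    obtain ⟨k, hk, hks, hkt⟩ := F.2.exists_le_le hs ht
    exact ⟨basic k, ⟨k, rfl⟩, hk, fun K hK => ⟨K.2.mem_of_le hks hK, K.2.mem_of_le hkt hK⟩⟩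
  sUnion_eq := Set.eq_univ_of_forall fun F => by
    obtain ⟨s, hs⟩ := F.2.nonempty
    exact ⟨basic s, ⟨s, rfl⟩, hs⟩
  eq_generateFrom := rfl

theorem isOpen_basic (s : S) : IsOpen (basic s) := isTopologicalBasis_basic.isOpen ⟨s, rfl⟩

theorem exists_basic_subset {U : Set (Spec S)} (hU : IsOpen U) {F : Spec S} (hF : F ∈ U) :
    ∃ s, F ∈ basic s ∧ basic s ⊆ U := by
  obtain ⟨_, ⟨s, rfl⟩, h⟩ := isTopologicalBasis_basic.exists_subset_of_mem_open hF hU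
  exact ⟨s, h⟩

theorem basic_subset_iff {s t : S} : basic s ⊆ basic t ↔ s ≤ t :=
  ⟨fun h => le_of_forall_isPrimeFilter fun F hF hs => h (a := ⟨F, hF⟩) hs,
    fun h F hF => F.2.mem_of_le h hF⟩

theorem basic_injective : Function.Injective (basic (S := S)) := fun _ _ h =>
  le_antisymm (basic_subset_iff.1 h.subset) (basic_subset_iff.1 h.symm.subset)

theorem basic_eq_iUnion {A : Set S} (hfin : A.Finite) {s : S} (h : IsLUB A s) :
    basic s = ⋃ a ∈ A, basic a := by
  refine Set.Subset.antisymm (fun F hF => ?_) ?_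
  · obtain ⟨a, ha, haF⟩ := F.2.exists_mem_of_isLUB hfin h hF
    exact Set.mem_iUnion₂.2 ⟨a, ha, haF⟩
  · exact Set.iUnion₂_subset fun a ha => basic_subset_iff.2 (h.1 ha)

theorem basic_eq_union {a b c : S} (h : IsLUB {a, b} c) : basic c = basic a ∪ basic b := by
  rw [basic_eq_iUnion (Set.toFinite _) h, Set.biUnion_pair]

theorem basic_eq_empty {z : S} (hz : IsBot z) : basic z = ∅ :=
  Set.eq_empty_of_forall_notMem fun F => F.2.1.2 z hz

/-- Basic sets are compact: the elements whose basic set is finitely covered form a lower set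
closed under joins, and a prime filter that misses this set is not covered. -/
theorem isCompact_basic (s : S) : IsCompact (basic s) := by
  refine isCompact_of_finite_subcover fun {ι} U hU hcov => ?_
  by_contra hs
  let I : Set S := {a | ∃ t : Finset ι, basic a ⊆ ⋃ i ∈ t, U i}
  have hlower : IsLowerSet I := by
    rintro a b hba ⟨t, ht⟩
    exact ⟨t, (basic_subset_iff.2 hba).trans ht⟩
  have hne : I.Nonempty := by
    obtain ⟨z, hz⟩ := exists_isBot S
    exact ⟨z, ∅, by rw [basic_eq_empty hz]; exact Set.empty_subset _⟩
  have hjoin : ∀ a b c : S, IsLUB {a, b} c → a ∈ I → b ∈ I → c ∈ I := by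
    classical
    rintro a b c hc ⟨t, ht⟩ ⟨t', ht'⟩
    refine ⟨t ∪ t', ?_⟩
    rw [basic_eq_union hc, Finset.set_biUnion_union]
    exact Set.union_subset_union ht ht'
  obtain ⟨F, hF, hsF, hdisj⟩ := exists_isPrimeFilter hlower hne hjoin hs
  obtain ⟨i, hi⟩ := Set.mem_iUnion.1 (hcov (a := ⟨F, hF⟩) hsF)
  obtain ⟨a, haF, ha⟩ := exists_basic_subset (hU i) hi
  exact Set.disjoint_left.1 hdisj haF ⟨{i}, by simpa using ha⟩

theorem isBisection_basic (s : S) : IsBisection (basic s) := by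
  constructor
  · rintro L ⟨_, ⟨F, hF, rfl⟩, K, hK, h⟩
    exact mem_identities_iff.2 ⟨s⁻¹ * s, mul_mem h (inv_mem_inv hF) hK, idem_inv_mul s⟩
  · rintro L ⟨F, hF, _, ⟨K, hK, rfl⟩, h⟩
    exact mem_identities_iff.2 ⟨s * s⁻¹, mul_mem h hF (inv_mem_inv hK), idem_mul_inv s⟩

theorem basic_mem (s : S) : basic s ∈ compactOpenBisections (Spec S) :=
  ⟨isCompact_basic s, isOpen_basic s, isBisection_basic s⟩

theorem setInv_basic (s : S) : setInv (basic s) = basic s⁻¹ := by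
  ext F
  rw [mem_setInv]
  rfl

theorem setMul_basic (s t : S) : setMul (basic s) (basic t) = basic (s * t) := by
  refine Set.Subset.antisymm ?_ fun L hL => ?_
  · rintro L ⟨F, hF, K, hK, h⟩
    exact mul_mem h hF hK
  -- Lift the domain of `L` to a filter `K` around `t`, and divide `L` by `K`.
  · obtain ⟨K, hK, hKL⟩ := exists_lift (dom_mem L) (t := t) (mem_dom.2 ⟨_, hL, by
      calc (s * t)⁻¹ * (s * t) = t⁻¹ * (s⁻¹ * s * t) := by
            rw [inv_of_mul]; simp only [mul_assoc]
        _ ≤ t⁻¹ * t := mul_le_mul le_rfl (idem_mul_le t (idem_inv_mul s))⟩)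
    obtain ⟨F, hF⟩ := exists_isMul (x := L) (y := PartialGroupoid.inv K) (by
      rw [ran_inv, hKL])
    have hFK := hF.inv_right
    rw [PartialGroupoid.inv_inv] at hFK
    refine ⟨F, ?_, K, hK, hFK⟩
    refine F.2.mem_of_le ?_ (mul_mem hF hL (inv_mem_inv hK))
    rw [mul_assoc]
    exact mul_idem_le s (idem_mul_inv t)

/-- If every prime filter around `s` is an identity, then `s` is idempotent. -/
theorem idem_of_basic_subset {s : S} (h : basic s ⊆ identities (Spec S)) : s * s = s := by
  have hle : s⁻¹ * s ≤ s := by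
    refine basic_subset_iff.1 fun E hE => ?_
    have hE' : E ∈ identities (Spec S) := mem_identities_iff.2 ⟨_, hE, idem_inv_mul s⟩
    obtain ⟨F, hF, hFE⟩ := exists_lift hE' hE
    rw [dom_of_identity (h hF)] at hFE
    exact hFE ▸ hF
  have hs := mul_inv_mul_of_le hle
  rw [inv_idem (idem_inv_mul s), idem_inv_mul, ← mul_assoc, mul_inv_mul] at hs
  rw [hs]
  exact hs ▸ idem_inv_mul s

/-- The compact-open bisections are exactly the basic sets. -/
theorem exists_eq_basic {A : Set (Spec S)} (hA : A ∈ compactOpenBisections (Spec S)) :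
    ∃ s, A = basic s := by
  obtain ⟨T, hT, hfin, hcov⟩ := hA.1.elim_finite_subcover_image
    (b := {s : S | basic s ⊆ A}) (c := basic) (fun s _ => isOpen_basic s) (fun F hF => by
      obtain ⟨s, hs, hsA⟩ := exists_basic_subset hA.2.1 hF
      exact Set.mem_iUnion₂.2 ⟨s, hsA, hs⟩)
  have hcompat : CompatibleSet T := by
    intro s hs t ht
    have hs' : setInv (basic s) ⊆ setInv A := Set.image_mono (hT hs)
    have ht' : setInv (basic t) ⊆ setInv A := Set.image_mono (hT ht)
    constructor
    · refine idem_of_basic_subset ?_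
      rw [← setMul_basic, ← setInv_basic]
      exact (setMul_mono hs' (hT ht)).trans hA.2.2.1
    · refine idem_of_basic_subset ?_
      rw [← setMul_basic, ← setInv_basic]
      exact (setMul_mono (hT hs) ht').trans hA.2.2.2
  obtain ⟨s, hs⟩ := DistributiveInverseSemigroup.exists_join T hfin hcompat
  refine ⟨s, ?_⟩
  rw [basic_eq_iUnion hfin hs]
  exact hcov.antisymm (Set.iUnion₂_subset fun t ht => hT ht)

theorem continuous_domMap : Continuous (domMap : Spec S → identities (Spec S)) := by
  refine Continuous.subtype_mk (isTopologicalBasis_basic.continuous_iff.2 ?_) _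
  rintro _ ⟨s, rfl⟩
  have : (fun F : Spec S => dom F) ⁻¹' basic s = ⋃ a ∈ {a : S | a⁻¹ * a ≤ s}, basic a := by
    ext F
    simp only [Set.mem_preimage, Set.mem_iUnion]
    refine mem_dom.trans ⟨?_, ?_⟩
    · rintro ⟨a, ha, h⟩
      exact ⟨a, h, ha⟩
    · rintro ⟨a, h, ha⟩
      exact ⟨a, ha, h⟩
  rw [this]
  exact isOpen_biUnion fun a _ => isOpen_basic a

theorem isOpenMap_domMap : IsOpenMap (domMap : Spec S → identities (Spec S)) := by
  refine isTopologicalBasis_basic.isOpenMap_iff.2 ?_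
  rintro _ ⟨t, rfl⟩
  have : domMap '' basic t = Subtype.val ⁻¹' basic (t⁻¹ * t) := by
    ext ⟨E, hE⟩
    constructor
    · rintro ⟨F, hF, h⟩
      have hE' : dom F = E := congrArg Subtype.val h
      exact hE' ▸ mem_dom.2 ⟨t, hF, le_rfl⟩
    · intro ht
      obtain ⟨F, hF, hFE⟩ := exists_lift hE ht
      exact ⟨F, hF, Subtype.ext hFE⟩
  rw [this]
  exact (isOpen_basic _).preimage continuous_subtype_val

theorem isEtale : IsEtale (Spec S) where
  continuous_inv := isTopologicalBasis_basic.continuous_iff.2 (by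
    rintro _ ⟨s, rfl⟩
    exact isOpen_basic s⁻¹)
  continuous_mul := isTopologicalBasis_basic.continuous_iff.2 (by
    rintro _ ⟨s, rfl⟩
    refine isOpen_iff_mem_nhds.2 ?_
    rintro ⟨⟨F, K⟩, h⟩ ⟨a, ha, b, hb, hab⟩
    have hopen : IsOpen ((fun p : {p : Spec S × Spec S // PartialGroupoid.Comp p.1 p.2} => p.1) ⁻¹'
        (basic a ×ˢ basic b)) :=
      ((isOpen_basic a).prod (isOpen_basic b)).preimage continuous_subtype_val
    refine Filter.mem_of_superset (hopen.mem_nhds ⟨ha, hb⟩) ?_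
    rintro ⟨⟨F', K'⟩, h'⟩ ⟨ha', hb'⟩
    exact ⟨a, ha', b, hb', hab⟩)
  isLocalHomeomorph_dom := by
    refine isLocalHomeomorph_iff_isOpenEmbedding_restrict.2 fun F => ?_
    obtain ⟨a, ha⟩ := F.2.nonempty
    refine ⟨basic a, (isOpen_basic a).mem_nhds ha, ?_⟩
    refine .of_continuous_injective_isOpenMap (continuous_domMap.comp continuous_subtype_val) ?_
      (isOpenMap_domMap.domRestrict (isOpen_basic a))
    rintro ⟨F, hF⟩ ⟨K, hK⟩ h
    exact Subtype.ext ((isBisection_basic a).eq_of_dom hF hK (congrArg Subtype.val h))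

/-- The basic set of `s` as an open bisection. -/
def openBasic (s : S) : OpenBisection (Spec S) := ⟨basic s, isOpen_basic s, isBisection_basic s⟩

theorem isCompletelyPrimeFilter_point (F : Spec S) :
    IsCompletelyPrimeFilter {U : OpenBisection (Spec S) | F ∈ U.1} := by
  refine ⟨⟨Order.IsPFilter.of_def ?_ ?_ ?_, ?_⟩, ?_⟩
  · obtain ⟨s, hs⟩ := F.2.nonempty
    exact ⟨openBasic s, hs⟩
  · intro U hU V hV
    exact ⟨⟨U.1 ∩ V.1, U.2.1.inter V.2.1, U.2.2.mono Set.inter_subset_left⟩, ⟨hU, hV⟩,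
      Set.inter_subset_left, Set.inter_subset_right⟩
  · exact fun {U V} hUV hU => hUV hU
  · intro Z hZ hF
    exact hZ ⟨∅, isOpen_empty, isBisection_iff.2 ⟨by simp, by simp⟩⟩ hF
  · intro 𝒰 V hV hF
    rw [OpenBisection.isLUB_iff] at hV
    change F ∈ V.1 at hF
    rw [hV] at hF
    obtain ⟨U, hU, hFU⟩ := Set.mem_iUnion₂.1 hF
    exact ⟨U, hU, hFU⟩

/-- The completely prime filter of open bisections around a point. -/
def toSpectrum (F : Spec S) : BisectionSpectrum (Spec S) :=
  ⟨{U | F ∈ U.1}, isCompletelyPrimeFilter_point F⟩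

/-- An open bisection in a completely prime filter contains a basic set in the filter. -/
theorem exists_openBasic_mem {𝓕 : Set (OpenBisection (Spec S))} (h𝓕 : IsCompletelyPrimeFilter 𝓕)
    {U : OpenBisection (Spec S)} (hU : U ∈ 𝓕) : ∃ s, openBasic s ∈ 𝓕 ∧ basic s ⊆ U.1 := by
  have hlub : IsLUB (openBasic '' {s : S | basic s ⊆ U.1}) U := by
    refine OpenBisection.isLUB_of_eq (Set.Subset.antisymm (fun F hF => ?_) ?_)
    · obtain ⟨s, hs, hsU⟩ := exists_basic_subset U.2.1 hF
      exact Set.mem_iUnion₂.2 ⟨_, ⟨s, hsU, rfl⟩, hs⟩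
    · refine Set.iUnion₂_subset ?_
      rintro _ ⟨s, hs, rfl⟩
      exact hs
  obtain ⟨_, ⟨s, hs, rfl⟩, hs'⟩ := h𝓕.2 _ _ hlub hU
  exact ⟨s, hs', hs⟩

theorem toSpectrum_bijective : Function.Bijective (toSpectrum (S := S)) := by
  constructor
  · intro F K h
    have h' : ∀ s, openBasic s ∈ (toSpectrum F).1 ↔ openBasic s ∈ (toSpectrum K).1 := by
      rw [h]; exact fun _ => Iff.rfl
    exact ext h'
  · rintro ⟨𝓕, h𝓕⟩
    have hup : ∀ {U V : OpenBisection (Spec S)}, U.1 ⊆ V.1 → U ∈ 𝓕 → V ∈ 𝓕 :=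
      fun h hU => h𝓕.1.1.toPFilter.mem_of_le h hU
    have hF : IsPrimeFilter {s : S | openBasic s ∈ 𝓕} := by
      refine .mk' ?_ ?_ ?_ ?_ ?_
      · obtain ⟨U, hU⟩ := h𝓕.1.1.toPFilter.nonempty
        obtain ⟨s, hs, -⟩ := exists_openBasic_mem h𝓕 hU
        exact ⟨s, hs⟩
      · intro a ha b hb
        obtain ⟨U, hU, hUa, hUb⟩ := h𝓕.1.1.toPFilter.directed _ ha _ hb
        obtain ⟨s, hs, hsU⟩ := exists_openBasic_mem h𝓕 hU
        exact ⟨s, hs, basic_subset_iff.1 (hsU.trans hUa), basic_subset_iff.1 (hsU.trans hUb)⟩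
      · exact fun a b hab ha => hup (basic_subset_iff.2 hab) ha
      · intro z hz hzF
        refine h𝓕.1.2 _ (fun U => ?_) hzF
        change basic z ⊆ U.1
        rw [basic_eq_empty hz]
        exact Set.empty_subset _
      · intro a b c hc hcF
        have hlub : IsLUB {openBasic a, openBasic b} (openBasic c) :=
          OpenBisection.isLUB_of_eq (by
            rw [Set.biUnion_pair]
            exact basic_eq_union hc)
        obtain ⟨U, hU, hUF⟩ := h𝓕.2 _ _ hlub hcF
        rcases hU with rfl | rfl
        exacts [Or.inl hUF, Or.inr hUF]
    refine ⟨⟨_, hF⟩, Subtype.ext (Set.ext fun U => ⟨fun hU => ?_, fun hU => ?_⟩)⟩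
    · obtain ⟨s, hs, hsU⟩ := exists_basic_subset U.2.1 hU
      exact hup (U := openBasic s) hsU hs
    · obtain ⟨s, hs, hsU⟩ := exists_openBasic_mem h𝓕 hU
      exact hsU hs

theorem isSober : IsSober (Spec S) := by
  have hpre : ∀ U : OpenBisection (Spec S),
      toSpectrum ⁻¹' {𝓕 : BisectionSpectrum (Spec S) | U ∈ 𝓕.1} = U.1 := fun U => rfl
  have hcont : Continuous (toSpectrum (S := S)) := by
    refine continuous_generateFrom_iff.2 ?_
    rintro _ ⟨U, rfl⟩
    rw [hpre]
    exact U.2.1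
  have hopen : IsOpenMap (toSpectrum (S := S)) := by
    refine isTopologicalBasis_basic.isOpenMap_iff.2 ?_
    rintro _ ⟨s, rfl⟩
    change IsOpen (toSpectrum '' (openBasic s).1)
    rw [← hpre, Set.image_preimage_eq _ toSpectrum_bijective.2]
    exact isOpen_generateFrom_of_mem ⟨_, rfl⟩
  exact ⟨(Equiv.ofBijective _ toSpectrum_bijective).toHomeomorphOfContinuousOpen hcont hopen,
    fun F => rfl⟩

theorem isCoherentEtale (S : Type u) [DistributiveInverseSemigroup S] :
    IsCoherentEtale (Spec S) where
  etale := isEtale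
  isBasis := isTopologicalBasis_of_isOpen_of_nhds (fun A hA => hA.2.1) fun F U hF hU => by
    obtain ⟨s, hs⟩ := exists_basic_subset hU hF
    exact ⟨basic s, basic_mem s, hs⟩
  mul_mem A hA B hB := by
    obtain ⟨s, rfl⟩ := exists_eq_basic hA
    obtain ⟨t, rfl⟩ := exists_eq_basic hB
    rw [setMul_basic]
    exact basic_mem _
  sober := isSober

/-- A distributive inverse semigroup is isomorphic to the semigroup of compact-open bisections of
its groupoid of prime filters. -/
noncomputable def mulEquivKB (S : Type u) [DistributiveInverseSemigroup S] :
    S ≃* KB (Spec S) (isCoherentEtale S) :=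
  MulEquiv.ofBijective
    (⟨fun s => ⟨basic s, basic_mem s⟩, fun s t => KB.ext (setMul_basic s t).symm⟩ :
      S →ₙ* KB (Spec S) (isCoherentEtale S))
    ⟨fun _ _ h => basic_injective (congrArg Subtype.val h), fun A => by
      obtain ⟨s, hs⟩ := exists_eq_basic A.2
      exact ⟨s, KB.ext hs.symm⟩⟩

end Spec

end SpectrumTopology

/-! ### The equivalence -/

section Equivalence

/-- An isomorphism of semigroups preserves the natural partial order, and is therefore
callitic. -/
def CalliticHom.ofMulEquiv {S : Type u} {T : Type v} [DistributiveInverseSemigroup S]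
    [DistributiveInverseSemigroup T] (e : S ≃* T) : CalliticHom S T :=
  have hle : ∀ {a b : S}, e a ≤ e b ↔ a ≤ b := fun {a b} => by
    constructor
    · rintro ⟨f, hf, h⟩
      refine ⟨e.symm f, by rw [← e.symm.map_mul, hf], e.injective ?_⟩
      rw [h, e.map_mul, e.apply_symm_apply]
    · rintro ⟨f, hf, rfl⟩
      exact ⟨e f, by rw [← e.map_mul, hf], e.map_mul _ _⟩
  { toFun := e
    map_mul := e.map_mul
    map_join := fun _ _ _ _ h =>
      (OrderIso.isLUB_image' (⟨e.toEquiv, hle⟩ : S ≃o T)).2 h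
    dc1 := fun s₁ s₂ t h₁ h₂ => by
      obtain ⟨s, rfl⟩ := e.surjective t
      exact ⟨s, hle.1 h₁, hle.1 h₂, le_rfl⟩
    dc2 := fun F hF => by
      obtain ⟨t, ht⟩ := hF.nonempty
      obtain ⟨s, rfl⟩ := e.surjective t
      exact ⟨s, ht⟩ }

/-- Semigroup isomorphisms are isomorphisms in the category of distributive inverse
semigroups. -/
def DistInvSgp.isoOfMulEquiv {S T : DistInvSgp.{u}} (e : S.carrier ≃* T.carrier) : S ≅ T where
  hom := CalliticHom.ofMulEquiv e
  inv := CalliticHom.ofMulEquiv e.symm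
  hom_inv_id := CalliticHom.ext (funext e.symm_apply_apply)
  inv_hom_id := CalliticHom.ext (funext e.apply_symm_apply)

instance : bisectionFunctor.{u}.EssSurj where
  mem_essImage S := ⟨⟨Spec S.unop.carrier, Spec.isCoherentEtale S.unop.carrier⟩,
    ⟨(DistInvSgp.isoOfMulEquiv (Spec.mulEquivKB S.unop.carrier)).op⟩⟩

instance : bisectionFunctor.{u}.IsEquivalence where

end Equivalence

end NCStone

theorem theorem3p17 : Nonempty (NCStone.DistInvSgp.{u}ᵒᵖ ≌ NCStone.CohEtaleGpd.{u}) :=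
  ⟨NCStone.bisectionFunctor.{u}.asEquivalence.symm⟩
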